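/- Let $n\ge 0$ and let $\exp:\mathbb C^n\to(\mathbb C^*)^n$ be the map $\exp(z_1,\dots,z_n)=(e^{2\pi i z_1},\dots,e^{2\pi i z_n})$. Let $S\subset\mathbb C^n$ be a Zariski closed subset defined over $\overline{\mathbb Q}$ (the common zero set of polynomials with coefficients in $\overline{\mathbb Q}$), and let $T\subset(\mathbb C^*)^n$ be an irreducible Zariski closed subset defined over $\overline{\mathbb Q}$. Suppose that $\dim S=\dim T$ and $\exp(S)\subset T$. Then $T$ is a torsion translate of a subtorus, that is, $T=\tau H$ for some point $\tau\in(\mathbb C^*)^n$ of finite order and some subtorus $H\subset(\mathbb C^*)^n$ (the image of an injective homomorphism of algebraic groups $(\mathbb C^*)^d\to(\mathbb C^*)^n$ for some $d\ge 0$). -/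

import Mathlib

open Topology

noncomputable section

namespace ExpTorus

/-- The field of algebraic numbers inside `ℂ`. -/
abbrev Qbar : IntermediateField ℚ ℂ := algebraicClosure ℚ ℂ

/-- The torus `(ℂ^*)^n`, with its coordinatewise group structure. -/
abbrev Torus (n : ℕ) : Type := Fin n → ℂˣ

/-- The inclusion of `(ℂ^*)^n` as an open subset of `ℂ^n`. -/
def Torus.incl {n : ℕ} (t : Torus n) : Fin n → ℂ := fun i => (t i : ℂ)

/-- The map `(z_1, …, z_n) ↦ (exp(2πi z_1), …, exp(2πi z_n))` from `ℂ^n` to `(ℂ^*)^n`. -/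
def expMap {n : ℕ} (z : Fin n → ℂ) : Torus n := fun i =>
  Units.mk0 (Complex.exp (2 * Real.pi * Complex.I * z i)) (Complex.exp_ne_zero _)

/-- The Zariski topology on `ℂ^n`, induced from the spectrum of the polynomial ring by sending a
point to the maximal ideal of the polynomials vanishing there. -/
abbrev zariski (n : ℕ) : TopologicalSpace (Fin n → ℂ) :=
  TopologicalSpace.induced (MvPolynomial.pointToPoint (σ := Fin n) (k := ℂ) (K := ℂ)) inferInstance

/-- The Zariski closed subsets of `ℂ^n` are the zero loci of polynomials. -/
theorem isClosed_zariski_iff {n : ℕ} (S : Set (Fin n → ℂ)) :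
    IsClosed[zariski n] S ↔
      ∃ P : Set (MvPolynomial (Fin n) ℂ), S = {z | ∀ p ∈ P, MvPolynomial.eval z p = 0} := by
  have key : ∀ P : Set (MvPolynomial (Fin n) ℂ),
      (MvPolynomial.pointToPoint (σ := Fin n) (k := ℂ) (K := ℂ)) ⁻¹' PrimeSpectrum.zeroLocus P =
        {z | ∀ p ∈ P, MvPolynomial.eval z p = 0} := by
    intro P
    ext z
    simp only [Set.mem_preimage, PrimeSpectrum.mem_zeroLocus, Set.mem_ofPred_eq, Set.subset_def,
      SetLike.mem_coe]
    refine forall₂_congr fun p _ => ?_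
    change p ∈ MvPolynomial.vanishingIdeal ℂ {z} ↔ _
    simp [MvPolynomial.aeval_eq_eval]
  rw [zariski, isClosed_induced_iff]
  constructor
  · rintro ⟨C, hC, rfl⟩
    obtain ⟨P, rfl⟩ := (PrimeSpectrum.isClosed_iff_zeroLocus C).1 hC
    exact ⟨P, key P⟩
  · rintro ⟨P, rfl⟩
    exact ⟨_, PrimeSpectrum.isClosed_zeroLocus P, key P⟩

/-- The Zariski topology on `(ℂ^*)^n`: the subspace topology of this open subset of `ℂ^n`. -/
abbrev torusZariski (n : ℕ) : TopologicalSpace (Torus n) :=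
  TopologicalSpace.induced Torus.incl (zariski n)

/-- `S ⊆ ℂ^n` is a Zariski closed subset defined over `ℚ̄`: the set of common zeros of a set of
polynomials with algebraic coefficients. -/
def IsClosedOverQbar {n : ℕ} (S : Set (Fin n → ℂ)) : Prop :=
  ∃ P : Set (MvPolynomial (Fin n) Qbar), S = {z | ∀ p ∈ P, MvPolynomial.aeval z p = 0}

/-- `T ⊆ (ℂ^*)^n` is a Zariski closed subset defined over `ℚ̄`: the set of common zeros in the torus
of a set of polynomials with algebraic coefficients (Laurent polynomials give the same sets, since
monomials are invertible on the torus). -/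
def IsTorusClosedOverQbar {n : ℕ} (T : Set (Torus n)) : Prop :=
  ∃ P : Set (MvPolynomial (Fin n) Qbar), T = {t | ∀ p ∈ P, MvPolynomial.aeval t.incl p = 0}

/-- The Krull dimension of a subset of a topological space (`⊥` for the empty set), for the
subspace topology. -/
def dimIn {X : Type*} (τ : TopologicalSpace X) (Z : Set X) : WithBot ℕ∞ :=
  @topologicalKrullDim Z (TopologicalSpace.induced Subtype.val τ)

/-- The homomorphism of algebraic tori `(ℂ^*)^d → (ℂ^*)^n` given by an integer matrix `A`, whose
`i`-th coordinate is the monomial `∏ j, s_j ^ (A i j)`. -/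
def monomialHom {d n : ℕ} (A : Matrix (Fin n) (Fin d) ℤ) : Torus d →* Torus n where
  toFun s := fun i => ∏ j, s j ^ A i j
  map_one' := by ext; simp
  map_mul' s t := by ext; simp [mul_zpow, Finset.prod_mul_distrib]

/-- A subtorus of `(ℂ^*)^n`: the image of an injective homomorphism of algebraic tori
`(ℂ^*)^d → (ℂ^*)^n`. -/
def IsSubtorus {n : ℕ} (H : Subgroup (Torus n)) : Prop :=
  ∃ (d : ℕ) (A : Matrix (Fin n) (Fin d) ℤ),
    Function.Injective (monomialHom A) ∧ H = (monomialHom A).range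

/-- A torsion translate of a subtorus: a coset `τ H` with `τ` of finite order and `H` a subtorus. -/
def IsTorsionTranslate {n : ℕ} (T : Set (Torus n)) : Prop :=
  ∃ (τ : Torus n) (H : Subgroup (Torus n)),
    IsOfFinOrder τ ∧ IsSubtorus H ∧ T = (fun h => τ * h) '' (H : Set (Torus n))

end ExpTorus

end

/-!
Let `D` be the common dimension of `S` and `T`, and let `S'` be the largest member of a chain of
length `D` of irreducible closed subsets of `S`. The integral linear forms that are constant on
`S'` make up a saturated lattice `Λ` (`constantForms`); let `k` be `n` minus its rank, and let `H`
be the subtorus of dimension `k` on which the characters in `Λ` are trivial. The theorem is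
obtained by comparing `T` with the coset `τ H` of `H` that contains `exp(S')`.

* `τ H ⊆ T`. A polynomial that vanishes on `T` restricts on `exp(S')` to a linear combination with
  constant coefficients of exponentials of linear forms whose differences are not constant on
  `S'`. Such exponentials are linearly independent, even over the ring of polynomial functions on
  `S'` (`MvPolynomial.mem_of_sum_mul_exp_eq_zero`), so the coefficients vanish, and with them the
  polynomial on all of `τ H` (`eval_eq_zero_of_mem_coset`). The linear independence is proved by
  shortening a relation: it is differentiated along a polynomial vector field tangent to the
  variety, chosen so that no nonzero rational function on the variety satisfies the differential
  equation of the exponential in question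
  (`MvPolynomial.exists_derivation_of_forall_sub_C_notMem`). Integral curves of the field exist by
  the Picard-Lindelöf theorem and stay in the variety by Grönwall's inequality, so no smooth
  points are needed.
* `τ H = T`. The forms in `Λ` are constant on `S'`, so `S'` lies in an affine space of dimension
  `k`, and `D ≤ k` (`length_le_of_forall_dot_eq`). If `τ H` were strictly contained in the
  irreducible set `T`, the dimension of `T` would be at least `k + 1`
  (`succ_le_topologicalKrullDim_of_coset_ssubset`).
* `τ` can be taken torsion. By the Nullstellensatz, `S` and `T` have points `z` and `t` with
  algebraic coordinates. For `m` in `Λ`, the number `m · z` is algebraic, and so is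
  `exp(2πi m · z)`, which is the value at `t` of the character `m`. Hence `m · z` is rational by a special case
  of the Gelfond-Schneider theorem (`exists_rat_of_isAlgebraic_of_isAlgebraic_exp`), and a coset
  of `H` on which all the characters in `Λ` are roots of unity is a torsion coset
  (`isTorsionTranslate_coset`).

The special case of the Gelfond-Schneider theorem is proved by Schneider's method. For an
irrational algebraic `x` with `exp(2πi x)` algebraic, Siegel's lemma gives a nonzero polynomial in
`z` and `exp(2πi z)` with zeros at the points `a + b x` with `a, b < s²`; the Schwarz lemma and
the Liouville inequality produce more and more zeros of this form, until the function is bounded,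
hence zero.
-/

/-! ### Derivations of function fields without exponentials -/

open Polynomial in
/-- For nonzero polynomials `p`, `q` and `m ≠ 0`, the function `y = p / q` is not a solution of
`y' = m y`, by comparison of degrees. -/
theorem Polynomial.derivative_mul_sub_ne_natCast_mul {A : Type*} [CommRing A] [IsDomain A]
    [CharZero A] {p q : A[X]} (hp : p ≠ 0) (hq : q ≠ 0) {m : ℕ} (hm : m ≠ 0) :
    q * derivative p - derivative q * p ≠ m * q * p := by
  intro h
  have h1 : (m * q * p).degree = q.degree + p.degree := by
    have : (m : A[X]) = C (m : A) := by simp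
    rw [degree_mul, degree_mul, this, degree_C (by exact_mod_cast hm), zero_add]
  have hp' := degree_derivative_lt hp
  have hq' := degree_derivative_lt hq
  have hqb : q.degree ≠ ⊥ := by simpa using hq
  have hpb : p.degree ≠ ⊥ := by simpa using hp
  have h2 : (q * derivative p - derivative q * p).degree < q.degree + p.degree := by
    refine (degree_sub_le _ _).trans_lt (max_lt ?_ ?_)
    · rw [degree_mul]
      exact WithBot.add_lt_add_left hqb hp'
    · rw [degree_mul]
      exact WithBot.add_lt_add_right hpb hq'
  rw [h, h1] at h2
  exact lt_irrefl _ h2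

open Polynomial TensorProduct in
/-- The derivation `d/dg` of `A[g]` extends to the field `K`, which is formally étale over `A[g]`,
and the extension has no nonzero eigenvector with eigenvalue `1`: such an element would be an
exponential of `g`, which cannot be algebraic over `A[g]`. -/
theorem exists_derivation_of_transcendental_of_isAlgebraic_adjoin {A K : Type*} [CommRing A]
    [IsDomain A] [CharZero A] [Field K] [Algebra A K] {g : K} (hg : Transcendental A g)
    (halg : Algebra.IsAlgebraic (Algebra.adjoin A {g}) K) :
    ∃ D : Derivation A K K, D g = 1 ∧ ∀ h, D h = h → h = 0 := by
  have hinj : Function.Injective (aeval (R := A) g) := transcendental_iff_injective.1 hg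
  let _ : Algebra A[X] K := (aeval (R := A) g).toRingHom.toAlgebra
  have hmap : ∀ p : A[X], algebraMap A[X] K p = aeval g p := fun _ => rfl
  have : IsScalarTower A A[X] K := IsScalarTower.of_algebraMap_eq fun a => by
    rw [hmap, Polynomial.algebraMap_apply, aeval_C]; rfl
  have : FaithfulSMul A[X] K := (faithfulSMul_iff_algebraMap_injective _ _).2 hinj
  have : Algebra.IsAlgebraic A[X] K := by
    have hmem : ∀ p : A[X], aeval g p ∈ Algebra.adjoin A {g} := fun p => by
      rw [Algebra.adjoin_singleton_eq_range_aeval]; exact ⟨p, rfl⟩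
    refine Algebra.IsAlgebraic.of_ringHom_of_comp_eq
      ((aeval (R := A) g).codRestrict (Algebra.adjoin A {g}) hmem) (RingHom.id K)
      (fun x => ?_) Function.injective_id rfl
    obtain ⟨p, hp⟩ : (x : K) ∈ (aeval (R := A) g).range := by
      rw [← Algebra.adjoin_singleton_eq_range_aeval]; exact x.2
    exact ⟨p, Subtype.ext hp⟩
  let _ : Algebra (FractionRing A[X]) K := FractionRing.liftAlgebra A[X] K
  have : IsScalarTower A[X] (FractionRing A[X]) K := inferInstance
  have : CharZero (FractionRing A[X]) :=
    charZero_of_injective_algebraMap (IsFractionRing.injective A[X] (FractionRing A[X]))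
  have : Algebra.IsAlgebraic (FractionRing A[X]) K :=
    IsFractionRing.comap_isAlgebraic_iff.1 ‹Algebra.IsAlgebraic A[X] K›
  have : Algebra.FormallyEtale (FractionRing A[X]) K := Algebra.FormallyEtale.of_isSeparable _ _
  have : Algebra.FormallyEtale A[X] (FractionRing A[X]) :=
    Algebra.FormallyEtale.of_isLocalization (nonZeroDivisors A[X])
  have : Algebra.FormallyEtale A[X] K := Algebra.FormallyEtale.comp _ (FractionRing A[X]) _
  let d : Derivation A A[X] K := Polynomial.mkDerivation A (1 : K)
  let e := KaehlerDifferential.tensorKaehlerEquivOfFormallyEtale A A[X] K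
  let φ : Ω[K⁄A] →ₗ[K] K :=
    (LinearMap.liftBaseChange K d.liftKaehlerDifferential) ∘ₗ e.symm.toLinearMap
  let D : Derivation A K K := φ.compDer (KaehlerDifferential.D A K)
  have hD : ∀ p : A[X], D (aeval g p) = aeval g (derivative p) := by
    intro p
    change LinearMap.liftBaseChange K d.liftKaehlerDifferential
      (e.symm (KaehlerDifferential.D A K (algebraMap A[X] K p))) = _
    rw [KaehlerDifferential.tensorKaehlerEquivOfFormallyEtale_symm_D_algebraMap]
    simp only [LinearMap.liftBaseChange_tmul, one_smul, Derivation.liftKaehlerDifferential_comp_D]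
    simp [d, mkDerivation_apply, Algebra.smul_def, hmap]
  refine ⟨D, by simpa using hD X, fun h hh => ?_⟩
  by_contra h0
  -- a polynomial of least degree over `A[X]` annihilating `h`
  have hex : ∃ m, ∃ q : A[X][X], q ≠ 0 ∧ aeval h q = 0 ∧ q.natDegree = m := by
    obtain ⟨q, hq, hqh⟩ := Algebra.IsAlgebraic.isAlgebraic (R := A[X]) h
    exact ⟨_, q, hq, hqh, rfl⟩
  classical
  obtain ⟨q, hq, hqh, hqm⟩ := Nat.find_spec hex
  set m := Nat.find hex with hm
  have hmin : ∀ r : A[X][X], aeval h r = 0 → r.natDegree < m → r = 0 := fun r hr hlt => by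
    by_contra hr0
    exact Nat.find_min hex hlt ⟨r, hr0, hr, rfl⟩
  have hev : ∀ r : A[X][X], r.natDegree ≤ m → aeval h r =
      ∑ i ∈ Finset.range (m + 1), aeval g (r.coeff i) * h ^ i := fun r hr => by
    rw [aeval_eq_sum_range' (n := m + 1) (by omega)]
    simp [Algebra.smul_def, hmap]
  have hm0 : m ≠ 0 := by
    intro h0'
    rw [h0'] at hqm
    rw [eq_C_of_natDegree_eq_zero hqm, aeval_C, hmap] at hqh
    apply hq
    rw [eq_C_of_natDegree_eq_zero hqm, (injective_iff_map_eq_zero _).1 hinj _ hqh, map_zero]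
  -- otherwise the relation could be divided by `h`
  have hc0 : q.coeff 0 ≠ 0 := by
    intro hc
    have hdx := q.divX_mul_X_add
    rw [hc, map_zero, add_zero] at hdx
    have h1 : aeval h q.divX = 0 := by
      rw [← hdx, map_mul, aeval_X] at hqh
      exact (mul_eq_zero.1 hqh).resolve_right h0
    have h2 := hmin _ h1 (by rw [natDegree_divX_eq_natDegree_tsub_one]; omega)
    rw [h2, zero_mul] at hdx
    exact hq hdx.symm
  have hcm : q.coeff m ≠ 0 := by rw [← hqm]; simpa using hq
  have hDq : ∑ i ∈ Finset.range (m + 1),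
      aeval g (derivative (q.coeff i) + (i : A[X]) * q.coeff i) * h ^ i = 0 := by
    have := congrArg D hqh
    rw [hev q hqm.le, map_sum, map_zero] at this
    rw [← this]
    refine Finset.sum_congr rfl fun i _ => ?_
    rw [Derivation.leibniz, Derivation.leibniz_pow, hD, hh]
    rcases i with _ | i
    · simp
    · simp [pow_succ]; ring
  -- eliminating the leading term between the relation for `h` and its derivative gives a relation
  -- of smaller degree, so the two relations are proportional; compare their constant terms
  let r : A[X][X] := ∑ i ∈ Finset.range (m + 1), monomial i
    (q.coeff m * (derivative (q.coeff i) + (i : A[X]) * q.coeff i) -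
      (derivative (q.coeff m) + (m : A[X]) * q.coeff m) * q.coeff i)
  have hrc : ∀ i, i ≤ m → r.coeff i =
      q.coeff m * (derivative (q.coeff i) + (i : A[X]) * q.coeff i) -
      (derivative (q.coeff m) + (m : A[X]) * q.coeff m) * q.coeff i := by
    intro i hi
    simp only [r, finsetSum_coeff, coeff_monomial]
    rw [Finset.sum_ite_eq', if_pos (by simp; omega)]
  have hrm : r.natDegree ≤ m := by
    refine natDegree_sum_le_of_forall_le _ _ fun i hi => (natDegree_monomial_le _).trans ?_
    have := Finset.mem_range.1 hi
    omega
  have hr0 : r = 0 := by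
    refine hmin r ?_ ?_
    · rw [hev r hrm]
      have : ∀ i ∈ Finset.range (m + 1), aeval g (r.coeff i) * h ^ i =
          aeval g (q.coeff m) * (aeval g (derivative (q.coeff i) + (i : A[X]) * q.coeff i) * h ^ i) -
          aeval g (derivative (q.coeff m) + (m : A[X]) * q.coeff m) * (aeval g (q.coeff i) * h ^ i) := by
        intro i hi
        rw [hrc i (by have := Finset.mem_range.1 hi; omega)]
        simp only [map_sub, map_mul]
        ring
      rw [Finset.sum_congr rfl this, Finset.sum_sub_distrib, ← Finset.mul_sum, ← Finset.mul_sum,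
        hDq, ← hev q hqm.le, hqh]
      simp
    · refine lt_of_le_of_ne hrm fun hrm' => ?_
      have hc : r.coeff m = 0 := by rw [hrc m le_rfl]; ring
      have : r = 0 := by rwa [← hrm', coeff_natDegree, leadingCoeff_eq_zero] at hc
      rw [this] at hrm'
      simp at hrm'
      omega
  have := hrc 0 (Nat.zero_le _)
  rw [hr0, coeff_zero] at this
  refine derivative_mul_sub_ne_natCast_mul hc0 hcm hm0 ?_
  push_cast at this
  linear_combination -this

/-- On an extension field of `k` there is a derivation over `k` sending a given transcendental
element `g` to `1`, for which no nonzero element behaves like the exponential of `g`. -/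
theorem exists_derivation_apply_eq_one {k K : Type*} [Field k] [CharZero k] [Field K] [Algebra k K]
    {g : K} (hg : Transcendental k g) :
    ∃ D : Derivation k K K, D g = 1 ∧ ∀ h, D h = h → h = 0 := by
  have hind : AlgebraicIndepOn k id ({g} : Set K) := by
    have := (AlgebraicIndepOn.insert_iff (R := k) (x := (id : K → K)) (s := ∅) (i := g)
      (Set.notMem_empty _)).2 ⟨(algebraicIndependent_empty_iff k K).2 (algebraMap k K).injective, by
        rw [Set.image_empty, Algebra.adjoin_empty]
        exact hg.ringHom_of_comp_eq (algebraMap k (⊥ : Subalgebra k K)) (RingHom.id K)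
          (fun x => by obtain ⟨y, hy⟩ := Algebra.mem_bot.1 x.2; exact ⟨y, Subtype.ext hy⟩)
          Function.injective_id rfl⟩
    simpa using this
  -- complete `g` to a transcendence basis `B`, and treat the rest of `B` as constants
  obtain ⟨B, hB, hBt⟩ := exists_isTranscendenceBasis_superset hind
  have hgB : g ∈ B := hB rfl
  have hBi : insert g (B \ {g}) = B := by simp [Set.insert_eq_of_mem hgB]
  have : CharZero (Algebra.adjoin k (B \ {g})) :=
    charZero_of_injective_algebraMap (algebraMap k (Algebra.adjoin k (B \ {g}))).injective
  have htr : Transcendental (Algebra.adjoin k (B \ {g})) g := by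
    have := ((AlgebraicIndepOn.insert_iff (R := k) (x := (id : K → K)) (s := B \ {g}) (i := g)
      (by simp)).1 (by rw [hBi]; exact hBt.1)).2
    rwa [Set.image_id] at this
  have halg : Algebra.IsAlgebraic (Algebra.adjoin (Algebra.adjoin k (B \ {g})) {g}) K := by
    have := hBt.isAlgebraic
    have hle : Algebra.adjoin k (Set.range ((↑) : B → K)) ≤
        (Algebra.adjoin (Algebra.adjoin k (B \ {g})) {g}).restrictScalars k := by
      rw [Subtype.range_coe, ← Algebra.adjoin_union_eq_adjoin_adjoin,
        Set.sdiff_union_of_subset hB]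
    exact Algebra.IsAlgebraic.ringHom_of_comp_eq (Subalgebra.inclusion hle) (RingHom.id K)
      (Subalgebra.inclusion_injective hle) Function.surjective_id rfl
  obtain ⟨D, h1, h2⟩ := exists_derivation_of_transcendental_of_isAlgebraic_adjoin htr halg
  exact ⟨D.restrictScalars k, h1, h2⟩

open MvPolynomial in
/-- A polynomial function `g` that is not constant on the variety of the prime ideal `I` admits a
polynomial vector field tangent to the variety along which no nonzero rational function `a / b` on
the variety satisfies `y' = y g'`. -/
theorem MvPolynomial.exists_derivation_of_forall_sub_C_notMem {k σ : Type*} [Field k] [CharZero k]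
    [IsAlgClosed k] [Finite σ] (I : Ideal (MvPolynomial σ k)) [I.IsPrime] {g : MvPolynomial σ k}
    (hg : ∀ c, g - C c ∉ I) :
    ∃ D : Derivation k (MvPolynomial σ k) (MvPolynomial σ k), (∀ p ∈ I, D p ∈ I) ∧
      ∀ a b, b ∉ I → b * D a - a * D b - a * b * D g ∈ I → a ∈ I := by
  let O := MvPolynomial σ k ⧸ I
  let K := FractionRing O
  let ρ : MvPolynomial σ k →ₐ[k] K := (IsScalarTower.toAlgHom k O K).comp (Ideal.Quotient.mkₐ k I)
  have hρ : ∀ p, ρ p = algebraMap O K (Ideal.Quotient.mk I p) := fun _ => rfl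
  have hker : ∀ p, ρ p = 0 ↔ p ∈ I := fun p => by
    rw [hρ, map_eq_zero_iff _ (IsFractionRing.injective O K), Ideal.Quotient.eq_zero_iff_mem]
  have htr : Transcendental k (ρ g) := by
    intro halg
    have hdeg := IsAlgClosed.degree_eq_one_of_irreducible k (minpoly.irreducible halg.isIntegral)
    obtain ⟨c, hc⟩ := minpoly.mem_range_of_degree_eq_one k _ hdeg
    refine hg c ((hker _).1 ?_)
    rw [map_sub, ← hc, ← MvPolynomial.algebraMap_eq, AlgHom.commutes, sub_self]
  obtain ⟨D, hDg, hD⟩ := exists_derivation_apply_eq_one htr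
  have := Fintype.ofFinite σ
  -- clear the denominators of the values of `D` on the coordinate functions
  obtain ⟨s, hs⟩ := IsLocalization.exist_integer_multiples_of_finite (nonZeroDivisors O)
    fun i : σ => D (ρ (X i))
  choose w hw using hs
  replace hw : ∀ i, algebraMap O K (w i) = algebraMap O K s * D (ρ (X i)) := fun i =>
    (hw i).trans (Algebra.smul_def _ _)
  choose v hv using fun i => Ideal.Quotient.mk_surjective (w i)
  have hs0 : algebraMap O K s ≠ 0 :=
    IsLocalization.to_map_ne_zero_of_mem_nonZeroDivisors K le_rfl s.2
  let D' := mkDerivation k v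
  have hD' : ∀ p, ρ (D' p) = algebraMap O K s * D (ρ p) := by
    intro p
    induction p using MvPolynomial.induction_on with
    | C c =>
      rw [← MvPolynomial.algebraMap_eq, Derivation.map_algebraMap, AlgHom.commutes,
        Derivation.map_algebraMap, map_zero, mul_zero]
    | add p q hp hq => simp only [map_add, hp, hq, mul_add]
    | mul_X p i hp =>
      rw [Derivation.leibniz, map_mul ρ, Derivation.leibniz, map_add, smul_eq_mul, smul_eq_mul,
        map_mul, map_mul, hp, mkDerivation_X, hρ (v i), hv, hw, smul_eq_mul, smul_eq_mul]
      ring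
  refine ⟨D', fun p hp => (hker _).1 ?_, fun a b hb hab => ?_⟩
  · rw [hD', (hker p).2 hp, map_zero, mul_zero]
  · rw [← hker] at hab hb ⊢
    simp only [map_sub, map_mul, hD', hDg] at hab
    have h1 : ρ b * D (ρ a) - ρ a * D (ρ b) = ρ a * ρ b := by
      refine mul_left_cancel₀ hs0 ?_
      linear_combination hab
    have h2 : D (ρ a / ρ b) = ρ a / ρ b := by
      rw [Derivation.leibniz_div]
      simp only [smul_eq_mul]
      rw [h1, div_eq_mul_inv]
      linear_combination (ρ a * (ρ b)⁻¹) * mul_inv_cancel₀ hb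
    exact (div_eq_zero_iff.1 (hD _ h2)).resolve_right hb

/-! ### Linear independence of exponentials on a variety -/

open MvPolynomial in
theorem MvPolynomial.contDiff_eval_real {σ : Type*} [Fintype σ] (p : MvPolynomial σ ℂ) :
    ContDiff ℝ 1 fun z : σ → ℂ => eval z p := by
  induction p using MvPolynomial.induction_on with
  | C c => simpa using contDiff_const
  | add p q hp hq => simpa using hp.add hq
  | mul_X p i hp => simpa using hp.mul (contDiff_apply ℝ ℂ i)

open MvPolynomial in
/-- The chain rule along an integral curve of the vector field of a derivation `D`. -/
theorem MvPolynomial.hasDerivAt_eval_comp {σ : Type*} [Fintype σ]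
    (D : Derivation ℂ (MvPolynomial σ ℂ) (MvPolynomial σ ℂ)) {z : ℝ → σ → ℂ} {t : ℝ}
    (hz : HasDerivAt z (fun i => eval (z t) (D (X i))) t) (p : MvPolynomial σ ℂ) :
    HasDerivAt (fun s => eval (z s) p) (eval (z t) (D p)) t := by
  induction p using MvPolynomial.induction_on with
  | C c =>
    rw [← MvPolynomial.algebraMap_eq, Derivation.map_algebraMap, map_zero]
    simpa using hasDerivAt_const t c
  | add p q hp hq => simpa using hp.fun_add hq
  | mul_X p i hp =>
    have := hp.fun_mul (hasDerivAt_pi.1 hz i)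
    simp only [Derivation.leibniz, smul_eq_mul, map_add, map_mul, eval_X]
    convert! this using 1
    ring

open MvPolynomial in
/-- An integral curve of the vector field of a derivation preserving an ideal stays in the zero
locus of the ideal: along the curve, the values of finitely many generators solve a homogeneous
linear system of differential equations, so Grönwall's inequality applies. -/
theorem MvPolynomial.eval_eq_zero_of_hasDerivAt {σ : Type*} [Fintype σ]
    (D : Derivation ℂ (MvPolynomial σ ℂ) (MvPolynomial σ ℂ)) {I : Ideal (MvPolynomial σ ℂ)}
    (hD : ∀ p ∈ I, D p ∈ I) {z : ℝ → σ → ℂ} {δ : ℝ}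
    (hz : ∀ t ∈ Set.Icc 0 δ, HasDerivAt z (fun i => eval (z t) (D (X i))) t)
    (h0 : ∀ p ∈ I, eval (z 0) p = 0) {t : ℝ} (ht : t ∈ Set.Icc 0 δ) {p : MvPolynomial σ ℂ}
    (hp : p ∈ I) : eval (z t) p = 0 := by
  obtain ⟨m, F, hF⟩ := Submodule.fg_iff_exists_fin_generating_family.1 (IsNoetherian.noetherian I)
  have hFI : ∀ k, F k ∈ I := fun k => hF ▸ Submodule.subset_span ⟨k, rfl⟩
  have hq : ∀ k, ∃ q : Fin m → MvPolynomial σ ℂ, ∑ l, q l * F l = D (F k) := fun k => by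
    have := hD _ (hFI k)
    rw [← hF] at this
    exact (Submodule.mem_span_range_iff_exists_fun _).1 this
  choose q hq using hq
  have hzc : ContinuousOn z (Set.Icc 0 δ) := fun s hs => (hz s hs).continuousAt.continuousWithinAt
  have hbd : ∀ k l, ∃ c, ∀ s ∈ Set.Icc 0 δ, ‖eval (z s) (q k l)‖ ≤ c := fun k l =>
    isCompact_Icc.exists_bound_of_continuousOn
      ((contDiff_eval_real (q k l)).continuous.comp_continuousOn hzc)
  choose c hc using hbd
  have hc0 : ∀ k l, 0 ≤ c k l := fun k l => (norm_nonneg _).trans (hc k l t ht)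
  let u : ℝ → Fin m → ℂ := fun s k => eval (z s) (F k)
  have hu : ∀ s ∈ Set.Icc 0 δ, HasDerivAt u (fun k => eval (z s) (D (F k))) s := fun s hs =>
    hasDerivAt_pi.2 fun k => hasDerivAt_eval_comp D (hz s hs) (F k)
  have hu0 : u 0 = 0 := by
    ext k
    exact h0 (F k) (hFI k)
  have hbound : ∀ s ∈ Set.Ico 0 δ,
      ‖fun k => eval (z s) (D (F k))‖ ≤ (∑ k, ∑ l, c k l) * ‖u s‖ := fun s hs => by
    refine (pi_norm_le_iff_of_nonneg (mul_nonneg (Finset.sum_nonneg fun k _ =>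
      Finset.sum_nonneg fun l _ => hc0 k l) (norm_nonneg _))).2 fun k => ?_
    rw [← hq k, map_sum]
    calc ‖∑ l, eval (z s) (q k l * F l)‖
        ≤ ∑ l, c k l * ‖u s‖ := by
          refine norm_sum_le_of_le _ fun l _ => ?_
          rw [map_mul, norm_mul]
          exact mul_le_mul (hc k l s (Set.Ico_subset_Icc_self hs))
            (norm_le_pi_norm (u s) l) (norm_nonneg _) (hc0 k l)
      _ ≤ (∑ k, ∑ l, c k l) * ‖u s‖ := by
          rw [← Finset.sum_mul]
          refine mul_le_mul_of_nonneg_right ?_ (norm_nonneg _)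
          exact Finset.single_le_sum (f := fun k => ∑ l, c k l)
            (fun k _ => Finset.sum_nonneg fun l _ => hc0 k l) (Finset.mem_univ k)
  have hzero : u t = 0 := eq_zero_of_abs_deriv_le_mul_abs_self_of_eq_zero_right
    (fun s hs => (hu s hs).continuousAt.continuousWithinAt)
    (fun s hs => (hu s (Set.Ico_subset_Icc_self hs)).hasDerivWithinAt)
    hu0 hbound t ht
  rw [← hF] at hp
  obtain ⟨b, rfl⟩ := (Submodule.mem_span_range_iff_exists_fun _).1 hp
  rw [map_sum]
  refine Finset.sum_eq_zero fun k _ => ?_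
  have : eval (z t) (F k) = 0 := congrFun hzero k
  rw [smul_eq_mul, map_mul, this, mul_zero]

open MvPolynomial in
/-- An exponential polynomial relation on the zero locus of an ideal can be differentiated along
every derivation preserving the ideal. -/
theorem MvPolynomial.sum_derivation_mul_exp_eq_zero {σ ι : Type*} [Fintype σ]
    (D : Derivation ℂ (MvPolynomial σ ℂ) (MvPolynomial σ ℂ)) {I : Ideal (MvPolynomial σ ℂ)}
    (hD : ∀ p ∈ I, D p ∈ I) {J : Finset ι} {a g : ι → MvPolynomial σ ℂ}
    (h : ∀ z : σ → ℂ, (∀ p ∈ I, eval z p = 0) →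
      ∑ j ∈ J, eval z (a j) * Complex.exp (eval z (g j)) = 0)
    {z : σ → ℂ} (hz : ∀ p ∈ I, eval z p = 0) :
    ∑ j ∈ J, eval z (D (a j) + a j * D (g j)) * Complex.exp (eval z (g j)) = 0 := by
  have hv : ContDiff ℝ 1 fun z : σ → ℂ => fun i => eval z (D (X i)) :=
    contDiff_pi.2 fun i => contDiff_eval_real _
  obtain ⟨γ, hγ0, ε, hε, hγ⟩ :=
    hv.contDiffAt.exists_forall_mem_closedBall_exists_eq_forall_mem_Ioo_hasDerivAt₀ (x₀ := z) 0
  have hγ' : ∀ t ∈ Set.Icc 0 (ε / 2), HasDerivAt γ (fun i => eval (γ t) (D (X i))) t :=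
    fun t ht => hγ t ⟨by linarith [ht.1], by linarith [ht.2]⟩
  have hd : HasDerivAt (fun t => ∑ j ∈ J, eval (γ t) (a j) * Complex.exp (eval (γ t) (g j)))
      (∑ j ∈ J, eval z (D (a j) + a j * D (g j)) * Complex.exp (eval z (g j))) 0 := by
    refine HasDerivAt.fun_sum fun j _ => ?_
    have h0 := hγ' 0 ⟨le_rfl, by positivity⟩
    convert! (hasDerivAt_eval_comp D h0 (a j)).mul (hasDerivAt_eval_comp D h0 (g j)).cexp using 1
    simp only [hγ0, map_add, map_mul]
    ring
  have hev : (fun t => ∑ j ∈ J, eval (γ t) (a j) * Complex.exp (eval (γ t) (g j)))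
      =ᶠ[nhdsWithin 0 (Set.Ici 0)] fun _ => 0 := by
    filter_upwards [Icc_mem_nhdsGE (show (0 : ℝ) < ε / 2 by positivity)] with t ht
    exact h _ fun p hp => eval_eq_zero_of_hasDerivAt D hD hγ' (by rwa [hγ0]) ht hp
  have h1 := hd.hasDerivWithinAt (s := Set.Ici 0)
  have h2 := (hasDerivWithinAt_const (0 : ℝ) (Set.Ici 0) (0 : ℂ)).congr_of_eventuallyEq hev
    (hev.eq_of_nhdsWithin Set.self_mem_Ici)
  exact (uniqueDiffWithinAt_Ici 0).eq_deriv _ h1 h2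

open MvPolynomial in
/-- Exponentials of polynomial functions with pairwise nonconstant differences on an irreducible
variety are linearly independent over the ring of polynomial functions on it. -/
theorem MvPolynomial.mem_of_sum_mul_exp_eq_zero {σ ι : Type*} [Fintype σ]
    {I : Ideal (MvPolynomial σ ℂ)} [I.IsPrime]
    (hI : ∀ p, (∀ z : σ → ℂ, (∀ q ∈ I, eval z q = 0) → eval z p = 0) → p ∈ I)
    {g : ι → MvPolynomial σ ℂ} (J : Finset ι)
    (hg : ∀ i ∈ J, ∀ j ∈ J, i ≠ j → ∀ c, g i - g j - C c ∉ I) (a : ι → MvPolynomial σ ℂ)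
    (h : ∀ z : σ → ℂ, (∀ p ∈ I, eval z p = 0) →
      ∑ j ∈ J, eval z (a j) * Complex.exp (eval z (g j)) = 0) :
    ∀ j ∈ J, a j ∈ I := by
  classical
  induction J using Finset.induction_on generalizing a with
  | empty => simp
  | insert i J hi ih =>
    have hJ : ∀ a : ι → MvPolynomial σ ℂ, (∀ z : σ → ℂ, (∀ p ∈ I, eval z p = 0) →
        ∑ j ∈ J, eval z (a j) * Complex.exp (eval z (g j)) = 0) → ∀ j ∈ J, a j ∈ I :=
      ih fun j hj k hk => hg j (Finset.mem_insert_of_mem hj) k (Finset.mem_insert_of_mem hk)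
    by_cases hai : a i ∈ I
    · refine Finset.forall_mem_insert _ _ _ |>.2 ⟨hai, hJ a fun z hz => ?_⟩
      have := h z hz
      rwa [Finset.sum_insert hi, hz _ hai, zero_mul, zero_add] at this
    · exfalso
      -- eliminating the `i`-th term between the relation and its derivative shortens it
      have hmem : ∀ j ∈ J, a j ∈ I := fun j hj => by
        obtain ⟨D, hDI, hD⟩ := exists_derivation_of_forall_sub_C_notMem I
          (hg i (Finset.mem_insert_self _ _) j (Finset.mem_insert_of_mem hj)
            (by rintro rfl; exact hi hj))
        refine hD (a j) (a i) hai ?_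
        have := hJ (fun j => a i * (D (a j) + a j * D (g j)) - (D (a i) + a i * D (g i)) * a j)
          (fun z hz => by
            have h1 := h z hz
            have h2 := sum_derivation_mul_exp_eq_zero D hDI h hz
            rw [Finset.sum_insert hi] at h1 h2
            simp only [map_sub, map_mul, sub_mul, mul_assoc, Finset.sum_sub_distrib,
              ← Finset.mul_sum]
            linear_combination eval z (a i) * h2 - eval z (D (a i) + a i * D (g i)) * h1) j hj
        convert this using 1
        rw [map_sub]
        ring
      refine hai (hI _ fun z hz => ?_)
      have := h z hz
      rw [Finset.sum_insert hi, Finset.sum_eq_zero fun j hj => by rw [hz _ (hmem j hj), zero_mul],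
        add_zero] at this
      exact (mul_eq_zero.1 this).resolve_right (Complex.exp_ne_zero _)

/-! ### Analytic and arithmetic estimates -/

theorem Differentiable.exists_eq_prod_mul {F : ℂ → ℂ} (hF : Differentiable ℂ F) (Z : Finset ℂ)
    (hZ : ∀ ζ ∈ Z, F ζ = 0) :
    ∃ G : ℂ → ℂ, Differentiable ℂ G ∧ ∀ z, F z = (∏ ζ ∈ Z, (z - ζ)) * G z := by
  classical
  induction Z using Finset.induction_on with
  | empty => exact ⟨F, hF, by simp⟩
  | insert ζ Z hζ ih =>
    obtain ⟨G, hG, hFG⟩ := ih fun ξ hξ => hZ ξ (Finset.mem_insert_of_mem hξ)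
    have hGζ : G ζ = 0 := by
      have := hZ ζ (Finset.mem_insert_self _ _)
      rw [hFG] at this
      refine (mul_eq_zero.1 this).resolve_left (Finset.prod_ne_zero_iff.2 fun ξ hξ => ?_)
      exact sub_ne_zero.2 (by rintro rfl; exact hζ hξ)
    refine ⟨dslope G ζ, ?_, fun z => ?_⟩
    · rw [← differentiableOn_univ] at hG ⊢
      exact (Complex.differentiableOn_dslope Filter.univ_mem).2 hG
    · have := sub_smul_dslope G ζ z
      rw [hGζ, sub_zero, smul_eq_mul] at this
      rw [hFG, Finset.prod_insert hζ, ← this]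
      ring

/-- The Schwarz lemma for a function with many zeros. On the circle of radius `5 * r` every factor
`z - ζ` is at least `4 * r`, and on the disc of radius `r` it is at most `2 * r`, so every zero
gains a factor `2`. -/
theorem Differentiable.norm_le_div_two_pow_card {F : ℂ → ℂ} (hF : Differentiable ℂ F) {Z : Finset ℂ}
    (hZ : ∀ ζ ∈ Z, F ζ = 0) {r B : ℝ} (hr : 0 < r) (hZr : ∀ ζ ∈ Z, ‖ζ‖ ≤ r)
    (hB : ∀ z, ‖z‖ = 5 * r → ‖F z‖ ≤ B) {w : ℂ} (hw : ‖w‖ ≤ r) :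
    ‖F w‖ ≤ B / 2 ^ Z.card := by
  obtain ⟨G, hG, hFG⟩ := hF.exists_eq_prod_mul Z hZ
  have hGB : ‖G w‖ ≤ B / (4 * r) ^ Z.card := by
    refine Complex.norm_le_of_forall_mem_frontier_norm_le (U := Metric.ball 0 (5 * r))
      Metric.isBounded_ball hG.diffContOnCl (fun z hz => ?_) (subset_closure ?_)
    · rw [frontier_ball _ (by positivity), mem_sphere_zero_iff_norm] at hz
      rw [le_div_iff₀ (by positivity)]
      refine le_trans ?_ (hB z hz)
      rw [hFG, norm_mul, mul_comm, norm_prod, ← Finset.prod_const]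
      refine mul_le_mul_of_nonneg_right ?_ (norm_nonneg _)
      refine Finset.prod_le_prod (fun _ _ => by positivity) fun ζ hζ => ?_
      have := norm_sub_norm_le z ζ
      have := hZr ζ hζ
      linarith
    · rw [mem_ball_zero_iff]
      linarith
  have hprod : ‖∏ ζ ∈ Z, (w - ζ)‖ ≤ (2 * r) ^ Z.card := by
    rw [norm_prod, ← Finset.prod_const]
    refine Finset.prod_le_prod (fun _ _ => norm_nonneg _) fun ζ hζ => ?_
    have := norm_sub_le w ζ
    have := hZr ζ hζ
    linarith
  calc ‖F w‖ ≤ (2 * r) ^ Z.card * (B / (4 * r) ^ Z.card) := by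
        rw [hFG, norm_mul]
        exact mul_le_mul hprod hGB (norm_nonneg _) (by positivity)
    _ = B / 2 ^ Z.card := by
        rw [show (4 : ℝ) * r = 2 * (2 * r) by ring, mul_pow 2 (2 * r)]
        field_simp

open NumberField in
/-- The Liouville inequality, in terms of the house, the largest absolute value of the conjugates:
the norm of a nonzero algebraic integer is at least `1`. -/
theorem NumberField.one_le_norm_mul_house_pow {K : Type*} [Field K] [NumberField K] (φ : K →+* ℂ)
    {x : 𝓞 K} (hx : x ≠ 0) :
    1 ≤ ‖φ x‖ * house (x : K) ^ (Module.finrank ℚ K - 1) := by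
  refine le_trans ?_ (norm_norm_le_norm_mul_house_pow (x : K) φ)
  rw [← Algebra.coe_norm_int, ← Rat.norm_cast_real]
  have : Algebra.norm ℤ x ≠ 0 := Algebra.norm_ne_zero_iff.2 hx
  simpa using Int.one_le_abs this |> fun h => (Int.cast_le (R := ℝ)).2 h

open NumberField in
/-- Siegel's lemma for twice as many unknowns as equations, with a constant that depends only on the
number field. -/
theorem NumberField.exists_siegel_const (K : Type*) [Field K] [NumberField K] :
    ∃ C : ℝ, 1 ≤ C ∧ ∀ {α β : Type} [Fintype α] [Fintype β] (a : Matrix α β (𝓞 K)) {A : ℝ},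
      a ≠ 0 → 0 < Fintype.card α → Fintype.card β = 2 * Fintype.card α →
      (∀ k l, house (a k l : K) ≤ A) →
      ∃ x : β → 𝓞 K, x ≠ 0 ∧ a.mulVec x = 0 ∧
        ∀ l, house (x l : K) ≤ C * (C * Fintype.card β * A) := by
  classical
  have key : ∃ C : ℝ, ∀ {α β : Type} [Fintype α] [Fintype β] (a : Matrix α β (𝓞 K)) {A : ℝ},
      a ≠ 0 → 0 < Fintype.card α → Fintype.card β = 2 * Fintype.card α →
      (∀ k l, house (a k l : K) ≤ A) →
      ∃ x : β → 𝓞 K, x ≠ 0 ∧ a.mulVec x = 0 ∧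
        ∀ l, house (x l : K) ≤ C * (C * Fintype.card β * A) := by
    -- the constant is the one in `house.exists_ne_zero_int_vec_house_le`, found by unification
    refine ⟨?_, fun {α β} _ _ a A ha h0 hcard hA => ?_⟩
    rotate_left
    obtain ⟨x, hx0, hx, hxA⟩ := house.exists_ne_zero_int_vec_house_le K a ha h0
      (by omega : Fintype.card α < Fintype.card β) rfl hA rfl
    refine ⟨x, hx0, hx, fun l => ?_⟩
    have hone : (Fintype.card α : ℝ) / (Fintype.card β - Fintype.card α) = 1 := by
      rw [hcard]
      push_cast
      rw [div_eq_one_iff_eq] <;> [ring; skip]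
      have : (Fintype.card α : ℝ) ≠ 0 := by positivity
      intro h
      apply this
      linarith
    have := hxA l
    rw [hone, Real.rpow_one] at this
    exact this
  obtain ⟨C, hC⟩ := key
  refine ⟨max 1 |C|, le_max_left _ _, fun {α β} _ _ a A ha h0 hcard hA => ?_⟩
  obtain ⟨x, hx0, hx, hxA⟩ := hC a ha h0 hcard hA
  refine ⟨x, hx0, hx, fun l => (hxA l).trans ?_⟩
  have hA0 : 0 ≤ A := by
    obtain ⟨k⟩ := Fintype.card_pos_iff.1 h0
    obtain ⟨l⟩ := Fintype.card_pos_iff.1 (by omega : 0 < Fintype.card β)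
    exact (house_nonneg _).trans (hA k l)
  have : C * (C * Fintype.card β * A) = |C| * (|C| * Fintype.card β * A) := by
    rw [← mul_assoc, ← mul_assoc, ← mul_assoc, ← mul_assoc, abs_mul_abs_self]
  rw [this]
  have := le_max_right 1 |C|
  gcongr

/-- The comparison of sizes behind Schneider's method: for a large parameter `s`, the gain
`2 ^ (M ^ 2)` of the Schwarz lemma exceeds the loss in the Liouville inequality as soon as
`s ^ 2 ≤ M`. -/
theorem exists_forall_pow_lt_two_pow_sq {c : ℝ} (hc : 1 ≤ c) (h : ℕ) :
    ∃ s : ℕ, 1 ≤ s ∧ ∀ M : ℕ, s ^ 2 ≤ M →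
      ((2 * c * M) ^ (10 * s ^ 3) * c ^ (3 * M * s)) ^ h < 2 ^ (M ^ 2) := by
  set Λ := Real.log (2 * c) with hΛ
  have hΛ0 : 0 ≤ Λ := Real.log_nonneg (by linarith)
  have hl2 : 0 < Real.log 2 := Real.log_pos one_lt_two
  obtain ⟨u, hu⟩ := exists_nat_gt (h * (13 * Λ + 40) / Real.log 2)
  rw [div_lt_iff₀ hl2] at hu
  refine ⟨u ^ 2 + 1, by omega, fun M hM => ?_⟩
  generalize hs : u ^ 2 + 1 = s at hM
  -- in terms of `y = M ^ (1 / 4)` the logarithm of the left side is of order at most `y ^ 7`, since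
  -- `s ≤ y ^ 2` and `log M ≤ 4 * y`, whereas that of the right side is of order `y ^ 8`
  set y : ℝ := √(√(M : ℝ)) with hy
  have hy0 : 0 ≤ y := Real.sqrt_nonneg _
  have hy2 : y ^ 2 = √(M : ℝ) := Real.sq_sqrt (Real.sqrt_nonneg _)
  have hy4 : y ^ 4 = M := by
    rw [show y ^ 4 = (y ^ 2) ^ 2 by ring, hy2, Real.sq_sqrt (Nat.cast_nonneg _)]
  have hsy : (s : ℝ) ≤ y ^ 2 := by
    rw [hy2]
    exact Real.le_sqrt_of_sq_le (by exact_mod_cast hM)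
  have hus : (u : ℝ) ^ 2 + 1 = s := by exact_mod_cast hs
  have huy : (u : ℝ) < y := lt_of_pow_lt_pow_left₀ 2 hy0 (by linarith)
  have hy1 : 1 ≤ y := by
    by_contra! hlt
    have : y ^ 2 < 1 := pow_lt_one₀ hy0 hlt two_ne_zero
    nlinarith [sq_nonneg (u : ℝ)]
  have hM0 : (0 : ℝ) < M := by rw [← hy4]; positivity
  have hlogM : Real.log (2 * c * M) ≤ (Λ + 4) * y := by
    rw [Real.log_mul (by positivity) hM0.ne', ← hy4, Real.log_pow]
    have := Real.log_le_self hy0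
    push_cast
    nlinarith
  have hlogc : Real.log c ≤ Λ := Real.log_le_log (by linarith) (by linarith)
  have hlogc0 : 0 ≤ Real.log c := Real.log_nonneg hc
  have hlogM0 : 0 ≤ Real.log (2 * c * M) := Real.log_nonneg (by
    have : (1 : ℝ) ≤ M := by rw [← hy4]; exact one_le_pow₀ hy1
    nlinarith)
  have hs3 : (s : ℝ) ^ 3 ≤ y ^ 6 := by
    rw [show y ^ 6 = (y ^ 2) ^ 3 by ring]
    gcongr
  rw [← Real.log_lt_log_iff (by positivity) (by positivity), Real.log_pow,
    Real.log_mul (by positivity) (by positivity), Real.log_pow, Real.log_pow, Real.log_pow]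
  push_cast
  have h1 : 10 * (s : ℝ) ^ 3 * Real.log (2 * c * M) ≤ 10 * y ^ 6 * ((Λ + 4) * y) := by
    gcongr
  have h2 : 3 * (M : ℝ) * s * Real.log c ≤ 3 * y ^ 4 * y ^ 2 * (Λ * y) := by
    rw [hy4]
    have : Real.log c ≤ Λ * y := hlogc.trans (le_mul_of_one_le_right hΛ0 hy1)
    gcongr
  calc (h : ℝ) * (10 * (s : ℝ) ^ 3 * Real.log (2 * c * M) + 3 * (M : ℝ) * s * Real.log c)
      ≤ h * (10 * y ^ 6 * ((Λ + 4) * y) + 3 * y ^ 4 * y ^ 2 * (Λ * y)) := by gcongr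
    _ = h * (13 * Λ + 40) * y ^ 7 := by ring
    _ < y * Real.log 2 * y ^ 7 := by
        have : u * Real.log 2 < y * Real.log 2 := by gcongr
        have : h * (13 * Λ + 40) < y * Real.log 2 := hu.trans this
        gcongr
    _ = (M : ℝ) ^ 2 * Real.log 2 := by rw [← hy4]; ring

/-! ### Schneider's method -/

open MvPolynomial in
/-- The functions `z ^ i * exp (2 π i j z)` are linearly independent. -/
theorem eq_zero_of_sum_mul_pow_mul_exp_eq_zero {m s : ℕ} (p : Fin m × Fin s → ℂ)
    (h : ∀ z : ℂ, ∑ l, p l * z ^ (l.1 : ℕ) * Complex.exp (2 * Real.pi * Complex.I * l.2 * z) = 0) :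
    p = 0 := by
  let g : Fin s → MvPolynomial Unit ℂ := fun j => C (2 * Real.pi * Complex.I * j) * X ()
  let a : Fin s → MvPolynomial Unit ℂ := fun j =>
    ∑ i : Fin m, monomial (Finsupp.single () (i : ℕ)) (p (i, j))
  have hprime : (⊥ : Ideal (MvPolynomial Unit ℂ)).IsPrime := Ideal.isPrime_bot
  have key := mem_of_sum_mul_exp_eq_zero (I := (⊥ : Ideal (MvPolynomial Unit ℂ)))
    (fun q hq => (Ideal.mem_bot).2 (MvPolynomial.funext fun z => by
      simpa using hq z (by simp))) (g := g) Finset.univ (fun i _ j _ hij c hc => by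
      rw [Ideal.mem_bot] at hc
      have h0 := congrArg (eval fun _ => 0) hc
      have h1 := congrArg (eval fun _ => 1) hc
      simp only [g, map_sub, map_mul, eval_C, eval_X, map_zero, mul_zero, mul_one] at h0 h1
      have h2 : 2 * Real.pi * Complex.I * ((i : ℕ) - (j : ℕ) : ℂ) = 0 := by
        linear_combination h1 - h0
      have h3 := (mul_eq_zero.1 h2).resolve_left Complex.two_pi_I_ne_zero
      exact hij (Fin.ext (by exact_mod_cast sub_eq_zero.1 h3))) a (fun z _ => by
      rw [← h (z ()), Fintype.sum_prod_type_right]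
      refine Finset.sum_congr rfl fun j _ => ?_
      simp only [a, g, map_sum, Finset.sum_mul]
      refine Finset.sum_congr rfl fun i _ => ?_
      simp [eval_monomial])
  funext l
  have hl := key l.2 (Finset.mem_univ _)
  rw [Ideal.mem_bot] at hl
  have hc := congrArg (coeff (Finsupp.single () (l.1 : ℕ))) hl
  simp only [a, coeff_sum, coeff_monomial, coeff_zero] at hc
  rw [Finset.sum_eq_single l.1] at hc
  · simpa using hc
  · intro i _ hi
    rw [if_neg]
    intro h
    exact hi (Fin.ext (by simpa using DFunLike.congr_fun h ()))
  · simp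

section Schneider

open NumberField

variable {K : Type*} [Field K] [NumberField K]

/-- The value of the monomial `X ^ i * Y ^ j` at `(a + b * (β / d), (α / d) ^ b)`, multiplied by the
power `d ^ (2 * s ^ 3 + M * s)` that makes it an algebraic integer for all
`i ≤ 2 * s ^ 3`, `j ≤ s`, `b ≤ M`. -/
def schneiderCoeff (d : ℤ) (β α : 𝓞 K) (s M a b i j : ℕ) : 𝓞 K :=
  d ^ (2 * s ^ 3 - i) * (d * a + b * β) ^ i * d ^ (M * s - b * j) * α ^ (b * j)

theorem map_schneiderCoeff (φ : K →+* ℂ) {d : ℤ} {β α : 𝓞 K} {x y : ℂ}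
    (hβ : φ β = d * x) (hα : φ α = d * y) {s M a b i j : ℕ} (hi : i ≤ 2 * s ^ 3) (hj : j ≤ s)
    (hb : b ≤ M) :
    φ (schneiderCoeff d β α s M a b i j) =
      d ^ (2 * s ^ 3 + M * s) * ((a + b * x) ^ i * y ^ (b * j)) := by
  have hbj : b * j ≤ M * s := Nat.mul_le_mul hb hj
  simp only [schneiderCoeff, map_mul, map_pow, map_add, map_intCast, map_natCast, hβ, hα]
  rw [show (d : ℂ) * a + b * (d * x) = d * (a + b * x) by ring, mul_pow, mul_pow]
  obtain ⟨u, hu⟩ := Nat.exists_eq_add_of_le hi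
  obtain ⟨v, hv⟩ := Nat.exists_eq_add_of_le hbj
  rw [hu, hv, Nat.add_sub_cancel_left, Nat.add_sub_cancel_left]
  ring

theorem house_schneiderCoeff_le {d : ℤ} {β α : 𝓞 K} {c : ℝ} (hc : 1 ≤ c) (hd : |(d : ℝ)| ≤ c)
    (hβ : house (β : K) ≤ c) (hα : house (α : K) ≤ c) {s M a b i j : ℕ} (hi : i ≤ 2 * s ^ 3)
    (hj : j ≤ s) (ha : a ≤ M) (hb : b ≤ M) (hM : 1 ≤ M) :
    house (schneiderCoeff d β α s M a b i j : K) ≤ (2 * c * M) ^ (2 * s ^ 3) * c ^ (M * s) := by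
  have hbj : b * j ≤ M * s := Nat.mul_le_mul hb hj
  have hM' : (1 : ℝ) ≤ M := by exact_mod_cast hM
  have ha' : (a : ℝ) ≤ M := by exact_mod_cast ha
  have hb' : (b : ℝ) ≤ M := by exact_mod_cast hb
  have hd' : house ((d : ℤ) : K) ≤ c := by rw [house_intCast]; exact_mod_cast hd
  have hlin : house ((d : K) * a + b * β) ≤ 2 * c * M := by
    refine (house_add_le _ _).trans ?_
    rw [mul_comm (d : K), house_nat_mul, house_nat_mul]
    have h1 : (a : ℝ) * house (d : K) ≤ M * c :=
      mul_le_mul ha' hd' (house_nonneg _) (by positivity)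
    have h2 : (b : ℝ) * house (β : K) ≤ M * c :=
      mul_le_mul hb' hβ (house_nonneg _) (by positivity)
    linarith
  have hpow : ∀ (x : K) (k : ℕ) (y : ℝ), house x ≤ y → house (x ^ k) ≤ y ^ k := fun x k y hxy =>
    (house_pow_le x k).trans (pow_le_pow_left₀ (house_nonneg _) hxy k)
  have hmul : ∀ (x y : K) (u v : ℝ), house x ≤ u → house y ≤ v → house (x * y) ≤ u * v :=
    fun x y u v hx hy => (house_mul_le x y).trans
      (mul_le_mul hx hy (house_nonneg _) ((house_nonneg _).trans hx))
  have hval : (schneiderCoeff d β α s M a b i j : K) =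
      (d : K) ^ (2 * s ^ 3 - i) * ((d : K) * a + b * β) ^ i * (d : K) ^ (M * s - b * j) *
        (α : K) ^ (b * j) := by
    simp [schneiderCoeff]
  rw [hval]
  have h2c : c ≤ 2 * c * M := by nlinarith
  calc _ ≤ (2 * c * M) ^ (2 * s ^ 3 - i) * (2 * c * M) ^ i * c ^ (M * s - b * j) * c ^ (b * j) :=
        hmul _ _ _ _ (hmul _ _ _ _ (hmul _ _ _ _ (hpow _ _ _ (hd'.trans h2c)) (hpow _ _ _ hlin))
          (hpow _ _ _ hd')) (hpow _ _ _ hα)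
    _ = (2 * c * M) ^ (2 * s ^ 3) * c ^ (M * s) := by
        rw [mul_assoc (_ * _), ← pow_add, ← pow_add, Nat.sub_add_cancel hi, Nat.sub_add_cancel hbj]

theorem norm_natCast_add_natCast_mul_le {x : ℂ} {M a b : ℕ} (ha : a ≤ M) (hb : b ≤ M) :
    ‖(a : ℂ) + b * x‖ ≤ (1 + ‖x‖) * M := by
  have ha' : (a : ℝ) ≤ M := by exact_mod_cast ha
  have hb' : (b : ℝ) ≤ M := by exact_mod_cast hb
  calc ‖(a : ℂ) + b * x‖ ≤ a + b * ‖x‖ := by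
        refine (norm_add_le _ _).trans ?_
        rw [norm_mul, Complex.norm_natCast, Complex.norm_natCast]
    _ ≤ M + M * ‖x‖ := by gcongr
    _ = (1 + ‖x‖) * M := by ring

/-- The exponential polynomial with coefficients `u`, of degree less than `m` in `z` and less than
`s` in `exp (2 π i z)`. -/
noncomputable def expPoly {m s : ℕ} (u : Fin m × Fin s → ℂ) (z : ℂ) : ℂ :=
  ∑ l, u l * z ^ (l.1 : ℕ) * Complex.exp (2 * Real.pi * Complex.I * l.2 * z)

theorem differentiable_expPoly {m s : ℕ} (u : Fin m × Fin s → ℂ) :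
    Differentiable ℂ (expPoly u) := by
  refine Differentiable.fun_sum fun l _ => ?_
  fun_prop

theorem norm_expPoly_le {m s : ℕ} {u : Fin m × Fin s → ℂ} {z : ℂ} {P R : ℝ}
    (hu : ∀ l, ‖u l‖ ≤ P) (hR : 1 ≤ R) (hz : ‖z‖ ≤ R) :
    ‖expPoly u z‖ ≤ m * s * (P * R ^ m * Real.exp (2 * Real.pi * s * ‖z‖)) := by
  calc ‖expPoly u z‖ ≤ ∑ _l : Fin m × Fin s, P * R ^ m * Real.exp (2 * Real.pi * s * ‖z‖) := by
        refine norm_sum_le_of_le _ fun l _ => ?_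
        have hP : 0 ≤ P := (norm_nonneg _).trans (hu l)
        rw [norm_mul, norm_mul, norm_pow]
        refine mul_le_mul (mul_le_mul (hu l) ?_ (by positivity) hP) ?_ (norm_nonneg _)
          (by positivity)
        · exact (pow_le_pow_left₀ (norm_nonneg _) hz _).trans (pow_le_pow_right₀ hR l.1.2.le)
        · refine (Complex.norm_exp_le_exp_norm _).trans (Real.exp_le_exp.2 ?_)
          have hl : ((l.2 : ℕ) : ℝ) ≤ s := by exact_mod_cast l.2.2.le
          simp only [norm_mul, Complex.norm_ofNat, Complex.norm_real, Complex.norm_I,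
            Complex.norm_natCast, Real.norm_eq_abs, abs_of_pos Real.pi_pos, mul_one]
          gcongr
    _ = _ := by
        simp only [Finset.sum_const, Finset.card_univ, nsmul_eq_mul, Fintype.card_prod,
          Fintype.card_fin, Nat.cast_mul]

/-- The value of an exponential polynomial with coefficients `p` at `a + b * (β / d)`, multiplied by
a power of `d` that makes it an algebraic integer. -/
def schneiderValue (d : ℤ) (β α : 𝓞 K) {s : ℕ} (p : Fin (2 * s ^ 3) × Fin s → 𝓞 K) (M a b : ℕ) :
    𝓞 K :=
  ∑ l, schneiderCoeff d β α s M a b l.1 l.2 * p l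

theorem map_schneiderValue (φ : K →+* ℂ) {d : ℤ} {β α : 𝓞 K} {x : ℂ} (hβ : φ β = d * x)
    (hα : φ α = d * Complex.exp (2 * Real.pi * Complex.I * x)) {s : ℕ}
    (p : Fin (2 * s ^ 3) × Fin s → 𝓞 K) {M : ℕ} (a : ℕ) {b : ℕ} (hb : b ≤ M) :
    φ (schneiderValue d β α p M a b) =
      d ^ (2 * s ^ 3 + M * s) * expPoly (fun l => φ (p l)) (a + b * x) := by
  simp only [schneiderValue, expPoly, map_sum, Finset.mul_sum]
  refine Finset.sum_congr rfl fun l _ => ?_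
  rw [map_mul, map_mul, map_schneiderCoeff φ hβ hα l.1.2.le l.2.2.le hb, ← Complex.exp_nat_mul]
  have : Complex.exp (2 * Real.pi * Complex.I * l.2 * (a + b * x)) =
      Complex.exp ((b * l.2 : ℕ) * (2 * Real.pi * Complex.I * x)) := by
    rw [Complex.exp_eq_exp_iff_exists_int]
    exact ⟨(l.2 : ℕ) * a, by push_cast; ring⟩
  rw [this]
  ring

theorem house_schneiderValue_le {d : ℤ} {β α : 𝓞 K} {c P : ℝ} (hc : 1 ≤ c) (hd : |(d : ℝ)| ≤ c)
    (hβ : house (β : K) ≤ c) (hα : house (α : K) ≤ c) {s : ℕ}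
    {p : Fin (2 * s ^ 3) × Fin s → 𝓞 K} (hp : ∀ l, house (p l : K) ≤ P) {M a b : ℕ}
    (ha : a ≤ M) (hb : b ≤ M) (hM : 1 ≤ M) :
    house (schneiderValue d β α p M a b : K) ≤
      2 * s ^ 4 * ((2 * c * M) ^ (2 * s ^ 3) * c ^ (M * s) * P) := by
  simp only [schneiderValue, map_sum, map_mul]
  refine (house_sum_le_sum_house _ _).trans ?_
  calc _ ≤ ∑ _l : Fin (2 * s ^ 3) × Fin s, (2 * c * M) ^ (2 * s ^ 3) * c ^ (M * s) * P := by
        refine Finset.sum_le_sum fun l _ => (house_mul_le _ _).trans ?_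
        exact mul_le_mul (house_schneiderCoeff_le hc hd hβ hα l.1.2.le l.2.2.le ha hb hM) (hp l)
          (house_nonneg _) (by positivity)
    _ = _ := by
        simp only [Finset.sum_const, Finset.card_univ, nsmul_eq_mul, Fintype.card_prod,
          Fintype.card_fin]
        push_cast
        ring

/-- By the Schwarz lemma, an entire function vanishing at many points `a + b * x` is small on a
large disc. -/
theorem norm_le_of_forall_eq_zero {F : ℂ → ℂ} (hF : Differentiable ℂ F) {x : ℂ}
    (hx : ∀ q : ℚ, x ≠ q) {M : ℕ} (hM : 1 ≤ M)
    (hF0 : ∀ a b : ℕ, a < M → b < M → F (a + b * x) = 0) {B : ℝ}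
    (hB : ∀ z, ‖z‖ = 5 * ((1 + ‖x‖) * M) → ‖F z‖ ≤ B) {w : ℂ} (hw : ‖w‖ ≤ (1 + ‖x‖) * M) :
    ‖F w‖ ≤ B / 2 ^ (M ^ 2) := by
  classical
  have hM1 : (1 : ℝ) ≤ M := by exact_mod_cast hM
  have hinj : ∀ a b a' b' : ℕ, (a : ℂ) + b * x = a' + b' * x → a = a' ∧ b = b' := by
    intro a b a' b' heq
    have hb : b = b' := by
      by_contra hne
      have hne' : (b : ℂ) - b' ≠ 0 := sub_ne_zero.2 (by exact_mod_cast hne)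
      refine hx ((a' - a : ℚ) / (b - b' : ℚ)) ?_
      push_cast
      rw [eq_div_iff hne']
      linear_combination heq
    subst hb
    exact ⟨by exact_mod_cast add_right_cancel heq, rfl⟩
  let Z : Finset ℂ := (Finset.range M ×ˢ Finset.range M).image fun ab => (ab.1 : ℂ) + ab.2 * x
  have hZ : Z.card = M ^ 2 := by
    rw [Finset.card_image_of_injOn]
    · simp [sq]
    · rintro ⟨a, b⟩ - ⟨a', b'⟩ - heq
      obtain ⟨h1, h2⟩ := hinj _ _ _ _ heq
      exact Prod.ext h1 h2
  rw [← hZ]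
  refine hF.norm_le_div_two_pow_card (fun ζ hζ => ?_) (r := (1 + ‖x‖) * M) (by positivity)
    (fun ζ hζ => ?_) hB hw
  · obtain ⟨⟨a, b⟩, hab, rfl⟩ := Finset.mem_image.1 hζ
    simp only [Finset.mem_product, Finset.mem_range] at hab
    exact hF0 a b hab.1 hab.2
  · obtain ⟨⟨a, b⟩, hab, rfl⟩ := Finset.mem_image.1 hζ
    simp only [Finset.mem_product, Finset.mem_range] at hab
    exact norm_natCast_add_natCast_mul_le hab.1.le hab.2.le

/-- A bound for the houses of the numbers `schneiderCoeff d β α s M a b i j`. -/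
def schneiderBound (c : ℝ) (s M : ℕ) : ℝ := (2 * c * M) ^ (2 * s ^ 3) * c ^ (M * s)

theorem one_le_schneiderBound {c : ℝ} (hc : 1 ≤ c) {s M : ℕ} (hM : 1 ≤ M) :
    1 ≤ schneiderBound c s M := by
  have : (1 : ℝ) ≤ M := by exact_mod_cast hM
  exact one_le_mul_of_one_le_of_one_le (one_le_pow₀ (by nlinarith)) (one_le_pow₀ hc)

theorem mul_schneiderBound_le {c : ℝ} (hc : 1 ≤ c) {s M : ℕ} (hM : s ^ 2 ≤ M) :
    c * (c * (2 * s ^ 4) * schneiderBound c s (s ^ 2)) ≤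
      (2 * c * M) ^ 2 * schneiderBound c s M := by
  have hMM : ((s ^ 2 : ℕ) : ℝ) ≤ M := by exact_mod_cast hM
  have hTT : schneiderBound c s (s ^ 2) ≤ schneiderBound c s M := by
    unfold schneiderBound
    gcongr
  have h0 : 0 ≤ schneiderBound c s (s ^ 2) := by
    unfold schneiderBound
    positivity
  have h1 : (2 : ℝ) * s ^ 4 ≤ 4 * M ^ 2 := by
    have h1 : (s : ℝ) ^ 2 ≤ M := by exact_mod_cast hM
    have h2 : ((s : ℝ) ^ 2) ^ 2 ≤ (M : ℝ) ^ 2 := by gcongr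
    nlinarith [sq_nonneg (M : ℝ)]
  calc c * (c * (2 * s ^ 4) * schneiderBound c s (s ^ 2))
      ≤ c * (c * (4 * M ^ 2) * schneiderBound c s M) := by gcongr
    _ = _ := by ring

theorem schneiderBound_mul_le {c : ℝ} (hc : 1 ≤ c) {s M : ℕ} (hs : 1 ≤ s) (hM : s ^ 2 ≤ M) :
    schneiderBound c s M * (2 * s ^ 4 *
      (schneiderBound c s M * ((2 * c * M) ^ 2 * schneiderBound c s M))) ≤
      (2 * c * M) ^ (10 * s ^ 3) * c ^ (3 * M * s) := by
  have hM1 : (1 : ℝ) ≤ M := by exact_mod_cast (Nat.one_le_pow 2 s hs).trans hM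
  have hs3 : 1 ≤ s ^ 3 := Nat.one_le_pow _ _ hs
  have h2c : 1 ≤ 2 * c * M := by nlinarith
  have h1 : (2 : ℝ) * s ^ 4 ≤ (2 * c * M) ^ 2 := by
    have h1 : (s : ℝ) ^ 2 ≤ M := by exact_mod_cast hM
    have h2 : ((s : ℝ) ^ 2) ^ 2 ≤ (M : ℝ) ^ 2 := by gcongr
    have h3 : (1 : ℝ) ≤ c ^ 2 := one_le_pow₀ hc
    nlinarith [sq_nonneg (M : ℝ)]
  calc _ = 2 * s ^ 4 * ((2 * c * M) ^ (2 + 6 * s ^ 3) * c ^ (3 * M * s)) := by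
        unfold schneiderBound
        ring
    _ ≤ (2 * c * M) ^ 2 * ((2 * c * M) ^ (2 + 6 * s ^ 3) * c ^ (3 * M * s)) := by gcongr
    _ = (2 * c * M) ^ (4 + 6 * s ^ 3) * c ^ (3 * M * s) := by ring
    _ ≤ (2 * c * M) ^ (10 * s ^ 3) * c ^ (3 * M * s) := by
        gcongr ?_ * _
        exact pow_le_pow_right₀ h2c (by omega)

/-- A special case of the Gelfond-Schneider theorem, for a number `x` whose multiple `d * x` and
whose exponential `exp (2 π i x)` come from a number field. -/
theorem exists_rat_of_map_eq_mul_exp (φ : K →+* ℂ) {d : ℤ} (hd : d ≠ 0) {β α : 𝓞 K} {x : ℂ}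
    (hβ : φ β = d * x) (hα : φ α = d * Complex.exp (2 * Real.pi * Complex.I * x)) :
    ∃ q : ℚ, x = q := by
  by_contra! hirr
  obtain ⟨C, hC1, hC⟩ := exists_siegel_const K
  -- one constant that dominates all the data that do not depend on the parameters `s` and `M`
  obtain ⟨c, hc1, hCc, hdc, hβc, hαc, hκc, hec⟩ : ∃ c : ℝ, 1 ≤ c ∧ C ≤ c ∧ |(d : ℝ)| ≤ c ∧
      house (β : K) ≤ c ∧ house (α : K) ≤ c ∧ 5 * (1 + ‖x‖) ≤ c ∧
      Real.exp (10 * Real.pi * (1 + ‖x‖)) ≤ c := by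
    have hβ0 := house_nonneg (β : K)
    have hα0 := house_nonneg (α : K)
    have hd0 := abs_nonneg (d : ℝ)
    have hx0 := norm_nonneg x
    have he0 := Real.exp_pos (10 * Real.pi * (1 + ‖x‖))
    refine ⟨C + |(d : ℝ)| + house (β : K) + house (α : K) + 5 * (1 + ‖x‖) +
      Real.exp (10 * Real.pi * (1 + ‖x‖)), ?_, ?_, ?_, ?_, ?_, ?_, ?_⟩ <;> linarith
  have hh1 : 1 ≤ Module.finrank ℚ K := Module.finrank_pos
  have hLiou := fun (y : 𝓞 K) (hy : y ≠ 0) => one_le_norm_mul_house_pow φ hy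
  obtain ⟨s, hs1, hs⟩ := exists_forall_pow_lt_two_pow_sq hc1 (Module.finrank ℚ K)
  generalize Module.finrank ℚ K = h at hh1 hs hLiou
  have hs3 : 1 ≤ s ^ 3 := Nat.one_le_pow _ _ hs1
  have hs2 : 1 ≤ s ^ 2 := Nat.one_le_pow _ _ hs1
  have hlow : ∀ M, s ^ 2 ≤ M → 1 ≤ M := fun M hM => hs2.trans hM
  -- the coefficients of the auxiliary function are given by Siegel's lemma
  let mat : Matrix (Fin (s ^ 2) × Fin (s ^ 2)) (Fin (2 * s ^ 3) × Fin s) (𝓞 K) := fun e l =>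
    schneiderCoeff d β α s (s ^ 2) e.1 e.2 l.1 l.2
  have hmat : mat ≠ 0 := by
    intro h0
    have := congrFun (congrFun h0 (⟨0, by omega⟩, ⟨0, by omega⟩)) (⟨0, by omega⟩, ⟨0, by omega⟩)
    simp [mat, schneiderCoeff, hd] at this
  obtain ⟨p, hp0, hp, hpT⟩ := hC mat (A := schneiderBound c s (s ^ 2)) hmat
    (by simp only [Fintype.card_prod, Fintype.card_fin]; positivity)
    (by simp only [Fintype.card_prod, Fintype.card_fin]; ring)
    (fun e l => house_schneiderCoeff_le hc1 hdc hβc hαc l.1.2.le l.2.2.le e.1.2.le e.2.2.le hs2)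
  set F : ℂ → ℂ := expPoly fun l => φ (p l) with hF
  have hFd : Differentiable ℂ F := differentiable_expPoly _
  have hξ : ∀ M a b, b ≤ M → φ (schneiderValue d β α p M a b) =
      d ^ (2 * s ^ 3 + M * s) * F (a + b * x) := fun M a b hb =>
    map_schneiderValue φ hβ hα p a hb
  have hdC : (d : ℂ) ≠ 0 := by exact_mod_cast hd
  have hξ0 : ∀ M a b, b ≤ M → schneiderValue d β α p M a b = 0 → F (a + b * x) = 0 := by
    intro M a b hb h0
    have := hξ M a b hb
    rw [h0, show ((0 : 𝓞 K) : K) = 0 from map_zero _, map_zero] at this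
    exact (mul_eq_zero.1 this.symm).resolve_left (pow_ne_zero _ hdC)
  have hpb : ∀ M, s ^ 2 ≤ M → ∀ l, house (p l : K) ≤ (2 * c * M) ^ 2 * schneiderBound c s M := by
    intro M hM l
    refine (hpT l).trans (le_trans ?_ (mul_schneiderBound_le hc1 hM))
    have := zero_le_one.trans (one_le_schneiderBound hc1 hs2 (s := s))
    have hcard : (Fintype.card (Fin (2 * s ^ 3) × Fin s) : ℝ) = 2 * s ^ 4 := by
      simp only [Fintype.card_prod, Fintype.card_fin]
      push_cast
      ring
    rw [hcard]
    gcongr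
  -- `B M` bounds the auxiliary function and the houses of its scaled values, and `Q M` also absorbs
  -- the power of the denominator `d`; both are kept opaque
  obtain ⟨B, hB⟩ : ∃ B : ℕ → ℝ, ∀ M, B M =
      2 * s ^ 4 * (schneiderBound c s M * ((2 * c * M) ^ 2 * schneiderBound c s M)) :=
    ⟨_, fun _ => rfl⟩
  obtain ⟨Q, hQ⟩ : ∃ Q : ℕ → ℝ, ∀ M, Q M = (2 * c * M) ^ (10 * s ^ 3) * c ^ (3 * M * s) :=
    ⟨_, fun _ => rfl⟩
  have hT1 : ∀ M, s ^ 2 ≤ M → 1 ≤ schneiderBound c s M := fun M hM =>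
    one_le_schneiderBound hc1 (hlow M hM)
  have hB0 : ∀ M, s ^ 2 ≤ M → 0 ≤ B M := fun M hM => by
    have := zero_le_one.trans (hT1 M hM)
    rw [hB]
    positivity
  have hTB : ∀ M, s ^ 2 ≤ M → schneiderBound c s M * B M ≤ Q M := fun M hM => by
    rw [hB, hQ]
    exact schneiderBound_mul_le hc1 hs1 hM
  have hBQ : ∀ M, s ^ 2 ≤ M → B M ≤ Q M := fun M hM =>
    (le_mul_of_one_le_left (hB0 M hM) (hT1 M hM)).trans (hTB M hM)
  have hQ1 : ∀ M, s ^ 2 ≤ M → 1 ≤ Q M := fun M hM => by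
    have : (1 : ℝ) ≤ M := by exact_mod_cast hlow M hM
    rw [hQ]
    exact one_le_mul_of_one_le_of_one_le (one_le_pow₀ (by nlinarith)) (one_le_pow₀ hc1)
  have hFB : ∀ M, s ^ 2 ≤ M → ∀ z : ℂ, ‖z‖ = 5 * ((1 + ‖x‖) * M) → ‖F z‖ ≤ B M := by
    intro M hM z hz
    have hM1 : (1 : ℝ) ≤ M := by exact_mod_cast hlow M hM
    have hT0 := zero_le_one.trans (hT1 M hM)
    refine (norm_expPoly_le (R := 2 * c * M) (fun l => (norm_embedding_le_house _ φ).trans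
      (hpb M hM l)) (by nlinarith) (by rw [hz]; nlinarith)).trans ?_
    have hexp : Real.exp (2 * Real.pi * s * ‖z‖) ≤ c ^ (M * s) := by
      rw [show 2 * Real.pi * s * ‖z‖ = (M * s : ℕ) * (10 * Real.pi * (1 + ‖x‖)) by
        rw [hz]; push_cast; ring, Real.exp_nat_mul]
      gcongr
    calc _ ≤ ((2 * s ^ 3 : ℕ) : ℝ) * s * ((2 * c * M) ^ 2 * schneiderBound c s M *
          (2 * c * M) ^ (2 * s ^ 3) * c ^ (M * s)) := by gcongr
      _ = B M := by
        rw [hB, schneiderBound]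
        push_cast
        ring
  have hsmall : ∀ M, s ^ 2 ≤ M → (∀ a b : ℕ, a < M → b < M → F (a + b * x) = 0) →
      ∀ w : ℂ, ‖w‖ ≤ (1 + ‖x‖) * M → ‖F w‖ ≤ B M / 2 ^ (M ^ 2) := fun M hM h0 w hw =>
    norm_le_of_forall_eq_zero hFd hirr (hlow M hM) h0 (hFB M hM) hw
  -- extrapolation: by the Liouville inequality, smallness forces further zeros
  have hzero : ∀ M, s ^ 2 ≤ M → ∀ a b : ℕ, a < M → b < M → F (a + b * x) = 0 := by
    intro M hM
    induction M, hM using Nat.le_induction with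
    | base =>
      intro a b ha hb
      exact hξ0 (s ^ 2) a b hb.le (congrFun hp (⟨a, ha⟩, ⟨b, hb⟩))
    | succ M hM ih =>
      intro a b ha hb
      have ha' := Nat.lt_succ_iff.1 ha
      have hb' := Nat.lt_succ_iff.1 hb
      have hM1 : (1 : ℝ) ≤ M := by exact_mod_cast hlow M hM
      have hT0 := zero_le_one.trans (hT1 M hM)
      have hQ0 := zero_le_one.trans (hQ1 M hM)
      refine hξ0 M a b hb' ?_
      by_contra hne
      have hdT : ‖(d : ℂ) ^ (2 * s ^ 3 + M * s)‖ ≤ schneiderBound c s M := by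
        rw [norm_pow, Complex.norm_intCast, pow_add, schneiderBound]
        have : |(d : ℝ)| ≤ 2 * c * M := by nlinarith
        gcongr
      have h2 : ‖φ (schneiderValue d β α p M a b)‖ ≤ Q M / 2 ^ (M ^ 2) := by
        rw [hξ M a b hb', norm_mul]
        calc _ ≤ schneiderBound c s M * (B M / 2 ^ (M ^ 2)) :=
              mul_le_mul hdT (hsmall M hM ih _ (norm_natCast_add_natCast_mul_le ha' hb'))
                (norm_nonneg _) hT0
          _ = schneiderBound c s M * B M / 2 ^ (M ^ 2) := by ring
          _ ≤ _ := by
              gcongr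
              exact hTB M hM
      have h3 : house (schneiderValue d β α p M a b : K) ≤ Q M := by
        refine le_trans ?_ (hBQ M hM)
        rw [hB]
        exact house_schneiderValue_le hc1 hdc hβc hαc (hpb M hM) ha' hb' (hlow M hM)
      have h4 := mul_le_mul h2 (pow_le_pow_left₀ (house_nonneg _) h3 (h - 1))
        (pow_nonneg (house_nonneg _) _) (by positivity)
      have h5 : Q M / 2 ^ (M ^ 2) * Q M ^ (h - 1) < 1 := by
        rw [div_mul_eq_mul_div, ← pow_succ', Nat.sub_add_cancel hh1, div_lt_one (by positivity), hQ]
        exact hs M hM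
      exact absurd (hLiou _ hne) (not_le.2 (h4.trans_lt h5))
  -- hence the auxiliary function is bounded, and by Liouville's theorem it vanishes identically
  have hbdd : ∀ w, ‖F w‖ ≤ 1 := by
    intro w
    obtain ⟨m, hm⟩ := exists_nat_ge ‖w‖
    have hM : s ^ 2 ≤ max (s ^ 2) m := le_max_left _ _
    have hmM : (m : ℝ) ≤ (max (s ^ 2) m : ℕ) := by exact_mod_cast le_max_right _ _
    generalize max (s ^ 2) m = M at hM hmM
    have hM1 : (1 : ℝ) ≤ M := by exact_mod_cast hlow M hM
    refine (hsmall M hM (hzero M hM) w (by nlinarith [norm_nonneg x])).trans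
      ((div_le_one (by positivity)).2 ?_)
    calc B M ≤ Q M := hBQ M hM
      _ ≤ Q M ^ h := le_self_pow₀ (hQ1 M hM) (by omega)
      _ ≤ 2 ^ M ^ 2 := by
        rw [hQ]
        exact (hs M hM).le
  have hF0 : ∀ z, F z = 0 := by
    intro z
    have h1 : F z = F 0 := hFd.apply_eq_apply_of_bounded
      ((Metric.isBounded_iff_subset_closedBall 0).2 ⟨1, by
        rintro _ ⟨w, rfl⟩; simpa using hbdd w⟩) z 0
    have h2 := hzero (s ^ 2) le_rfl 0 0 (by omega) (by omega)
    rw [h1]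
    simpa using h2
  refine hp0 (funext fun l => ?_)
  have := congrFun (eq_zero_of_sum_mul_pow_mul_exp_eq_zero (fun l => φ (p l)) hF0) l
  simpa using this

end Schneider

/-- A special case of the Gelfond-Schneider theorem: an algebraic number `x` for which
`exp (2 π i x)` is algebraic is rational. -/
theorem exists_rat_of_isAlgebraic_of_isAlgebraic_exp {x : ℂ} (hx : IsAlgebraic ℚ x)
    (hy : IsAlgebraic ℚ (Complex.exp (2 * Real.pi * Complex.I * x))) : ∃ q : ℚ, x = q := by
  set y := Complex.exp (2 * Real.pi * Complex.I * x) with hy'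
  let K := IntermediateField.adjoin ℚ ({x, y} : Set ℂ)
  have hfin : FiniteDimensional ℚ K := IntermediateField.finiteDimensional_adjoin (by
    rintro z (rfl | rfl)
    · exact hx.isIntegral
    · exact hy.isIntegral)
  have : NumberField K := ⟨⟩
  let x' : K := ⟨x, IntermediateField.subset_adjoin _ _ (by simp)⟩
  let y' : K := ⟨y, IntermediateField.subset_adjoin _ _ (by simp)⟩
  have hZ : Algebra.IsAlgebraic ℤ K :=
    IsFractionRing.comap_isAlgebraic_iff (K := ℚ).2 inferInstance
  -- the product of a denominator of `x` and one of `y` serves both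
  obtain ⟨d, hd, hdx⟩ := IsAlgebraic.exists_integral_multiple (hZ.isAlgebraic x')
  obtain ⟨e, he, hey⟩ := IsAlgebraic.exists_integral_multiple (hZ.isAlgebraic y')
  have h1 : IsIntegral ℤ ((d * e : ℤ) * x') := by
    have := hdx.smul e
    rwa [smul_smul, zsmul_eq_mul, mul_comm e d] at this
  have h2 : IsIntegral ℤ ((d * e : ℤ) * y') := by
    have := hey.smul d
    rwa [smul_smul, zsmul_eq_mul] at this
  exact exists_rat_of_map_eq_mul_exp (algebraMap K ℂ) (mul_ne_zero hd he) (β := ⟨_, h1⟩)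
    (α := ⟨_, h2⟩) (by simp [x']) (by simp [y', hy'])

/-! ### Krull dimension and the Zariski topologies -/

theorem Topology.IsInducing.isIrreducible_preimage {X Y : Type*} [TopologicalSpace X]
    [TopologicalSpace Y] {f : X → Y} (hf : IsInducing f) {C : Set Y} (hC : IsIrreducible C)
    (hCf : C ⊆ Set.range f) : IsIrreducible (f ⁻¹' C) := by
  refine ⟨?_, fun u v hu hv => ?_⟩
  · obtain ⟨y, hy⟩ := hC.nonempty
    obtain ⟨x, rfl⟩ := hCf hy
    exact ⟨x, hy⟩
  · obtain ⟨u', hu', rfl⟩ := hf.isOpen_iff.1 hu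
    obtain ⟨v', hv', rfl⟩ := hf.isOpen_iff.1 hv
    rintro ⟨x, hx, hxu⟩ ⟨y, hy, hyv⟩
    obtain ⟨z, hz, hzu, hzv⟩ := hC.isPreirreducible u' v' hu' hv' ⟨_, hx, hxu⟩ ⟨_, hy, hyv⟩
    obtain ⟨w, rfl⟩ := hCf hz
    exact ⟨w, hz, hzu, hzv⟩

open TopologicalSpace in
/-- A chain of irreducible closed sets inside the range of an inducing map can be pulled back. -/
theorem Topology.IsInducing.length_le_topologicalKrullDim {X Y : Type*} [TopologicalSpace X]
    [TopologicalSpace Y] {f : X → Y} (hf : IsInducing f) (l : LTSeries (IrreducibleCloseds Y))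
    (hl : (l.last : Set Y) ⊆ Set.range f) : (l.length : WithBot ℕ∞) ≤ topologicalKrullDim X := by
  have hle : ∀ i, (l i : Set Y) ⊆ Set.range f := fun i =>
    Set.Subset.trans (SetLike.coe_subset_coe.2 (l.monotone (Fin.le_last i))) hl
  let l' : LTSeries (IrreducibleCloseds X) :=
    { length := l.length
      toFun := fun i => ⟨f ⁻¹' l i, hf.isIrreducible_preimage (l i).isIrreducible (hle i),
        (l i).isClosed.preimage hf.continuous⟩
      step := fun i => by
        have hlt : l i.castSucc < l i.succ := l.step i
        refine lt_of_le_not_ge (Set.preimage_mono (SetLike.coe_subset_coe.2 hlt.le)) fun hge => ?_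
        refine hlt.not_ge fun y hy => ?_
        obtain ⟨x, rfl⟩ := hle _ hy
        exact hge hy }
  exact Order.le_krullDim_iff.2 ⟨l', rfl⟩

open TopologicalSpace in
theorem IsClosed.exists_ltSeries_of_le_topologicalKrullDim {X : Type*} [TopologicalSpace X]
    {Y : Set X} (hY : IsClosed Y) {D : ℕ} (hD : (D : WithBot ℕ∞) ≤ topologicalKrullDim Y) :
    ∃ l : LTSeries (IrreducibleCloseds X), l.length = D ∧ (l.last : Set X) ⊆ Y := by
  obtain ⟨l, hl⟩ := Order.le_krullDim_iff.1 hD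
  refine ⟨l.map _ (IrreducibleCloseds.map_strictMono_of_isInducing IsInducing.subtypeVal), hl, ?_⟩
  rw [LTSeries.last_map, IrreducibleCloseds.coe_map]
  exact closure_minimal (by rintro _ ⟨y, -, rfl⟩; exact y.2) hY

theorem MvPolynomial.eval_bind₁ {σ τ R : Type*} [CommRing R] (f : σ → MvPolynomial τ R)
    (z : τ → R) (p : MvPolynomial σ R) :
    MvPolynomial.eval z (MvPolynomial.bind₁ f p) =
      MvPolynomial.eval (fun i => MvPolynomial.eval z (f i)) p := by
  induction p using MvPolynomial.induction_on with
  | C a => simp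
  | add a b ha hb => simp [ha, hb]
  | mul_X a i ha => simp [ha]

namespace ExpTorus

/-- The set `ℂ^n`, as a topological space with the Zariski topology. A separate type keeps this
topology apart from the product topology. -/
def ZAffine (n : ℕ) : Type := Fin n → ℂ

noncomputable instance (n : ℕ) : TopologicalSpace (ZAffine n) := zariski n

/-- The set `(ℂ^*)^n`, as a topological space with the Zariski topology. A separate type keeps this
topology apart from the product topology. -/
def ZTorus (n : ℕ) : Type := Torus n

noncomputable instance (n : ℕ) : TopologicalSpace (ZTorus n) := torusZariski n

theorem ZAffine.isClosed_iff {n : ℕ} (S : Set (ZAffine n)) : IsClosed S ↔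
    ∃ P : Set (MvPolynomial (Fin n) ℂ), S = {z | ∀ p ∈ P, MvPolynomial.eval z p = 0} :=
  isClosed_zariski_iff S

/-- The inclusion of `(ℂ^*)^n` in `ℂ^n`. -/
def ZTorus.toAffine {n : ℕ} : ZTorus n → ZAffine n := Torus.incl

theorem ZTorus.isInducing_toAffine {n : ℕ} : IsInducing (ZTorus.toAffine (n := n)) := ⟨rfl⟩

theorem ZTorus.isClosed_iff {n : ℕ} (T : Set (ZTorus n)) : IsClosed T ↔
    ∃ P : Set (MvPolynomial (Fin n) ℂ),
      T = {t : ZTorus n | ∀ p ∈ P, MvPolynomial.eval (Torus.incl t) p = 0} := by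
  rw [ZTorus.isInducing_toAffine.isClosed_iff]
  constructor
  · rintro ⟨S, hS, rfl⟩
    obtain ⟨P, rfl⟩ := (ZAffine.isClosed_iff S).1 hS
    exact ⟨P, rfl⟩
  · rintro ⟨P, rfl⟩
    exact ⟨_, (ZAffine.isClosed_iff _).2 ⟨P, rfl⟩, rfl⟩

theorem ZTorus.isClosed_setOf_eval {n : ℕ} (p : MvPolynomial (Fin n) ℂ) :
    IsClosed {t : ZTorus n | MvPolynomial.eval (Torus.incl t) p = 0} :=
  (ZTorus.isClosed_iff _).2 ⟨{p}, by simp⟩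

theorem ZAffine.isClosed_setOf_eval {n : ℕ} (p : MvPolynomial (Fin n) ℂ) :
    IsClosed {z : ZAffine n | MvPolynomial.eval z p = 0} :=
  (ZAffine.isClosed_iff _).2 ⟨{p}, by simp; rfl⟩

/-- The polynomial map `ℂ^m → ℂ^n` with coordinates `f`. -/
noncomputable def ZAffine.polyMap {m n : ℕ} (f : Fin n → MvPolynomial (Fin m) ℂ) :
    ZAffine m → ZAffine n :=
  fun z i => MvPolynomial.eval z (f i)

theorem ZAffine.continuous_polyMap {m n : ℕ} (f : Fin n → MvPolynomial (Fin m) ℂ) :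
    Continuous (ZAffine.polyMap f) := by
  refine continuous_iff_isClosed.2 fun S hS => ?_
  obtain ⟨P, rfl⟩ := (ZAffine.isClosed_iff S).1 hS
  refine (ZAffine.isClosed_iff _).2 ⟨(MvPolynomial.bind₁ f) '' P, Set.ext fun z => ?_⟩
  change (∀ p ∈ P, MvPolynomial.eval (fun i => MvPolynomial.eval z (f i)) p = 0) ↔
    ∀ q ∈ MvPolynomial.bind₁ f '' P, MvPolynomial.eval z q = 0
  rw [Set.forall_mem_image]
  exact forall₂_congr fun p _ => iff_of_eq (congrArg (· = 0) (MvPolynomial.eval_bind₁ f z p).symm)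

theorem ZAffine.topologicalKrullDim_le (n : ℕ) : topologicalKrullDim (ZAffine n) ≤ n := by
  have : IsInducing (fun z : ZAffine n => MvPolynomial.pointToPoint (k := ℂ) z) := ⟨rfl⟩
  refine this.topologicalKrullDim_le.trans ?_
  rw [PrimeSpectrum.topologicalKrullDim_eq_ringKrullDim,
    MvPolynomial.ringKrullDim_of_isNoetherianRing, ringKrullDim_eq_zero_of_field]
  simp

theorem ZTorus.topologicalKrullDim_le (n : ℕ) : topologicalKrullDim (ZTorus n) ≤ n :=
  ZTorus.isInducing_toAffine.topologicalKrullDim_le.trans (ZAffine.topologicalKrullDim_le n)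

theorem isPrime_vanishingIdeal {n : ℕ} {S : Set (ZAffine n)} (hS : IsIrreducible S) :
    (MvPolynomial.vanishingIdeal ℂ S).IsPrime := by
  refine ⟨fun h => ?_, fun {p q} hpq => ?_⟩
  · obtain ⟨z, hz⟩ := hS.nonempty
    have h1 : (1 : MvPolynomial (Fin n) ℂ) ∈ MvPolynomial.vanishingIdeal ℂ S := h ▸ trivial
    simpa using h1 z hz
  · refine (isPreirreducible_iff_isClosed_union_isClosed.1 hS.isPreirreducible _ _
      (ZAffine.isClosed_setOf_eval p) (ZAffine.isClosed_setOf_eval q) fun z hz => ?_).imp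
      (fun h z hz => ?_) (fun h z hz => ?_)
    · have := hpq z hz
      rw [map_mul] at this
      exact mul_eq_zero.1 this
    · exact h hz
    · exact h hz

/-- The image of a map into the torus that is holomorphic along complex lines is irreducible for
the Zariski topology, because the product of two nonzero holomorphic functions is nonzero. -/
theorem ZTorus.isIrreducible_range {n : ℕ} {E : Type*} [AddCommGroup E] [Module ℂ E]
    (f : E → ZTorus n)
    (hf : ∀ u v i, Differentiable ℂ fun c : ℂ => Torus.incl (f (u + c • v)) i) :
    IsIrreducible (Set.range f) := by
  refine ⟨⟨_, 0, rfl⟩, isPreirreducible_iff_isClosed_union_isClosed.2 fun Z₁ Z₂ h₁ h₂ hZ => ?_⟩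
  obtain ⟨P, rfl⟩ := (ZTorus.isClosed_iff Z₁).1 h₁
  obtain ⟨Q, rfl⟩ := (ZTorus.isClosed_iff Z₂).1 h₂
  by_contra! hcon
  simp only [Set.not_subset, Set.mem_ofPred_eq, not_forall] at hcon
  obtain ⟨⟨_, ⟨u, rfl⟩, p, hp, hpu⟩, ⟨_, ⟨v, rfl⟩, q, hq, hqv⟩⟩ := hcon
  have han : ∀ r : MvPolynomial (Fin n) ℂ, AnalyticOnNhd ℂ
      (fun c : ℂ => MvPolynomial.eval (Torus.incl (f (u + c • (v - u)))) r) Set.univ := by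
    intro r
    rw [Complex.analyticOnNhd_univ_iff_differentiable]
    induction r using MvPolynomial.induction_on with
    | C a => simp
    | add a b ha hb => simpa using ha.fun_add hb
    | mul_X a i ha => simpa using ha.fun_mul (hf u (v - u) i)
  have hmul := AnalyticOnNhd.eq_zero_or_eq_zero_of_mul_eq_zero (han p) (han q) (fun c _ => by
    rcases hZ ⟨u + c • (v - u), rfl⟩ with h | h
    · rw [h p hp, zero_mul]
    · rw [h q hq, mul_zero]) isPreconnected_univ
  rcases hmul with h | h
  · exact hpu (by simpa using h 0 trivial)
  · exact hqv (by simpa using h 1 trivial)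

/-! ### Characters, linear forms and cosets of subtori -/

/-- The character `t ↦ ∏ i, t i ^ m i` of `(ℂ^*)^n`. -/
def chi {n : ℕ} (m : Fin n → ℤ) (t : Torus n) : ℂˣ := ∏ i, t i ^ m i

/-- The linear form `z ↦ ∑ i, m i * z i` on `ℂ^n`. -/
def dot {n : ℕ} (m : Fin n → ℤ) (z : Fin n → ℂ) : ℂ := ∑ i, m i * z i

theorem chi_add {n : ℕ} (m m' : Fin n → ℤ) (t : Torus n) : chi (m + m') t = chi m t * chi m' t := by
  simp [chi, zpow_add, Finset.prod_mul_distrib]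

theorem chi_mul {n : ℕ} (m : Fin n → ℤ) (t t' : Torus n) : chi m (t * t') = chi m t * chi m t' := by
  simp [chi, mul_zpow, Finset.prod_mul_distrib]

theorem chi_inv {n : ℕ} (m : Fin n → ℤ) (t : Torus n) : chi m t⁻¹ = (chi m t)⁻¹ := by
  simp [chi]

theorem chi_zsmul {n : ℕ} (c : ℤ) (m : Fin n → ℤ) (t : Torus n) : chi (c • m) t = chi m t ^ c := by
  simp [chi, mul_comm c, zpow_mul, Finset.prod_zpow]

theorem chi_sum {n : ℕ} {ι : Type*} (s : Finset ι) (m : ι → Fin n → ℤ) (t : Torus n) :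
    chi (∑ j ∈ s, m j) t = ∏ j ∈ s, chi (m j) t := by
  classical
  induction s using Finset.induction_on with
  | empty => simp [chi]
  | insert j s hj ih => rw [Finset.sum_insert hj, Finset.prod_insert hj, chi_add, ih]

theorem chi_single {n : ℕ} (i : Fin n) (t : Torus n) : chi (Pi.single i 1) t = t i := by
  rw [chi, Finset.prod_eq_single i]
  · simp
  · intro j _ hj
    simp [hj]
  · simp

theorem chi_map {k n : ℕ} (f : (Fin k → ℤ) →ₗ[ℤ] (Fin n → ℤ)) (v : Fin k → ℤ) (t : Torus n) :
    chi (f v) t = chi v (fun j => chi (f (Pi.single j 1)) t) := by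
  rw [LinearMap.pi_apply_eq_sum_univ f v, chi_sum]
  simp only [chi_zsmul]
  refine Finset.prod_congr rfl fun j _ => ?_
  congr 3
  ext i
  simp [Pi.single_apply, eq_comm]

theorem dot_add {n : ℕ} (m m' : Fin n → ℤ) (z : Fin n → ℂ) :
    dot (m + m') z = dot m z + dot m' z := by
  simp [dot, add_mul, Finset.sum_add_distrib]

theorem dot_zsmul {n : ℕ} (c : ℤ) (m : Fin n → ℤ) (z : Fin n → ℂ) :
    dot (c • m) z = c * dot m z := by
  simp [dot, Finset.mul_sum, mul_assoc]

theorem dot_sub {n : ℕ} (m m' : Fin n → ℤ) (z : Fin n → ℂ) :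
    dot (m - m') z = dot m z - dot m' z := by
  simp [dot, sub_mul, Finset.sum_sub_distrib]

theorem dot_sub_right {n : ℕ} (m : Fin n → ℤ) (z w : Fin n → ℂ) :
    dot m (z - w) = dot m z - dot m w := by
  simp [dot, mul_sub, Finset.sum_sub_distrib]

theorem dot_single {n : ℕ} (i : Fin n) (z : Fin n → ℂ) : dot (Pi.single i 1) z = z i := by
  simp [dot, Pi.single_apply]

theorem dot_map {k n : ℕ} (f : (Fin k → ℤ) →ₗ[ℤ] (Fin n → ℤ)) (v : Fin k → ℤ) (z : Fin n → ℂ) :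
    dot (f v) z = dot v (fun j => dot (f (Pi.single j 1)) z) := by
  have hsum : ∀ (s : Finset (Fin k)) (m : Fin k → Fin n → ℤ),
      dot (∑ j ∈ s, m j) z = ∑ j ∈ s, dot (m j) z := by
    intro s m
    classical
    induction s using Finset.induction_on with
    | empty => simp [dot]
    | insert j s hj ih => rw [Finset.sum_insert hj, Finset.sum_insert hj, dot_add, ih]
  rw [LinearMap.pi_apply_eq_sum_univ f v, hsum]
  simp only [dot_zsmul]
  refine Finset.sum_congr rfl fun j _ => ?_
  congr 3
  ext i
  simp [Pi.single_apply, eq_comm]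

theorem chi_expMap {n : ℕ} (m : Fin n → ℤ) (z : Fin n → ℂ) :
    (chi m (expMap z) : ℂ) = Complex.exp (2 * Real.pi * Complex.I * dot m z) := by
  simp only [chi, expMap, dot, Units.coe_prod, Units.val_zpow_eq_zpow_val, Units.val_mk0,
    Finset.mul_sum, Complex.exp_sum, ← Complex.exp_int_mul]
  refine Finset.prod_congr rfl fun i _ => ?_
  congr 1
  ring

/-- The quotient of `ℤ^n` by a saturated sublattice is free, so the sublattice is the kernel of a
split surjection onto some `ℤ^k`. -/
theorem exists_projection_section {n : ℕ} (Λ : Submodule ℤ (Fin n → ℤ))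
    (hΛ : ∀ (a : ℤ) m, a ≠ 0 → a • m ∈ Λ → m ∈ Λ) :
    ∃ (k : ℕ) (π : (Fin n → ℤ) →ₗ[ℤ] (Fin k → ℤ)) (σ : (Fin k → ℤ) →ₗ[ℤ] (Fin n → ℤ)),
      (∀ v, π (σ v) = v) ∧ ∀ m, π m = 0 ↔ m ∈ Λ := by
  have htf : Module.IsTorsionFree ℤ ((Fin n → ℤ) ⧸ Λ) := by
    refine Module.IsTorsionFree.of_smul_eq_zero fun a x hax => ?_
    obtain ⟨m, rfl⟩ := Λ.mkQ_surjective x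
    by_contra! hcon
    rw [← map_smul, Submodule.mkQ_apply, Submodule.Quotient.mk_eq_zero] at hax
    exact hcon.2 ((Submodule.Quotient.mk_eq_zero _).2 (hΛ a m hcon.1 hax))
  obtain ⟨k, b⟩ := Module.basisOfFiniteTypeTorsionFree' (R := ℤ) (M := (Fin n → ℤ) ⧸ Λ)
  obtain ⟨σ, hσ⟩ := Module.projective_lifting_property Λ.mkQ b.equivFun.symm.toLinearMap
    Λ.mkQ_surjective
  refine ⟨k, b.equivFun.toLinearMap ∘ₗ Λ.mkQ, σ, fun v => ?_, fun m => ?_⟩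
  · have := LinearMap.congr_fun hσ v
    simp only [LinearMap.comp_apply, LinearEquiv.coe_coe] at this ⊢
    rw [this, LinearEquiv.apply_symm_apply]
  · simp

section Coset

variable {k n : ℕ} (π : (Fin n → ℤ) →ₗ[ℤ] (Fin k → ℤ)) (σ : (Fin k → ℤ) →ₗ[ℤ] (Fin n → ℤ))

/-- The matrix whose rows are the images of the basis vectors under `π`. The homomorphism
`(ℂ^*)^k → (ℂ^*)^n` given by it is the dual of `π`. -/
def rowMatrix : Matrix (Fin n) (Fin k) ℤ := fun i => π (Pi.single i 1)

theorem monomialHom_rowMatrix_apply (s : Torus k) (i : Fin n) :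
    monomialHom (rowMatrix π) s i = chi (π (Pi.single i 1)) s := rfl

theorem chi_monomialHom (m : Fin n → ℤ) (s : Torus k) :
    chi m (monomialHom (rowMatrix π) s) = chi (π m) s :=
  (chi_map π m s).symm

variable {π σ}

/-- A point on which the characters in the kernel of `π` are trivial lies in the subtorus defined by
`π`, and the section `σ` gives its parameters. -/
theorem monomialHom_chi (hπσ : ∀ v, π (σ v) = v) {y : Torus n} (hy : ∀ m, π m = 0 → chi m y = 1) :
    monomialHom (rowMatrix π) (fun j => chi (σ (Pi.single j 1)) y) = y := by
  funext i
  rw [monomialHom_rowMatrix_apply, ← chi_map σ]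
  have h1 := hy (Pi.single i 1 - σ (π (Pi.single i 1))) (by rw [map_sub, hπσ, sub_self])
  have h2 := chi_add (Pi.single i 1 - σ (π (Pi.single i 1))) (σ (π (Pi.single i 1))) y
  rw [sub_add_cancel, h1, one_mul, chi_single] at h2
  exact h2.symm

theorem monomialHom_rowMatrix_injective (hπσ : ∀ v, π (σ v) = v) :
    Function.Injective (monomialHom (rowMatrix π)) := by
  intro s s' h
  funext j
  rw [← chi_single j s, ← chi_single j s', ← hπσ (Pi.single j 1), ← chi_monomialHom π,
    ← chi_monomialHom π, h]

/-- The coset through `τ` of the subtorus defined by `π`, given by equations: the set on which the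
characters in the kernel of `π` take the same values as at `τ`. -/
def coset (π : (Fin n → ℤ) →ₗ[ℤ] (Fin k → ℤ)) (τ : Torus n) : Set (Torus n) :=
  {t | ∀ m, π m = 0 → chi m t = chi m τ}

theorem coset_eq (hπσ : ∀ v, π (σ v) = v) (τ : Torus n) :
    coset π τ = (fun h => τ * h) '' ((monomialHom (rowMatrix π)).range : Set (Torus n)) := by
  ext t
  constructor
  · intro ht
    refine ⟨τ⁻¹ * t, ⟨_, monomialHom_chi hπσ fun m hm => ?_⟩, mul_inv_cancel_left _ _⟩
    rw [chi_mul, chi_inv, ht m hm, inv_mul_cancel]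
  · rintro ⟨_, ⟨s, rfl⟩, rfl⟩ m hm
    rw [chi_mul, chi_monomialHom, hm]
    simp [chi]

end Coset

/-! ### The Zariski closure of the exponential of a variety -/

section FunctionalLindemann

variable {k n : ℕ} {π : (Fin n → ℤ) →ₗ[ℤ] (Fin k → ℤ)} {σ : (Fin k → ℤ) →ₗ[ℤ] (Fin n → ℤ)}

open MvPolynomial in
/-- Functional Lindemann-Weierstrass: the Zariski closure of the image under `expMap` of an
irreducible variety is the smallest coset of a subtorus that contains it. -/
theorem eval_eq_zero_of_mem_coset {S : Set (Fin n → ℂ)} (hS : IsIrreducible (X := ZAffine n) S)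
    (hSc : IsClosed (X := ZAffine n) S)
    (hπσ : ∀ v, π (σ v) = v) (hπ : ∀ m, π m = 0 ↔ ∃ c, ∀ z ∈ S, dot m z = c)
    {p : MvPolynomial (Fin n) ℂ} (hp : ∀ z ∈ S, eval (expMap z).incl p = 0) {z₀ : Fin n → ℂ}
    (hz₀ : z₀ ∈ S) {t : Torus n} (ht : t ∈ coset π (expMap z₀)) : eval t.incl p = 0 := by
  classical
  let ex : (Fin n →₀ ℕ) → Fin n → ℤ := fun u i => u i
  let b : (Fin k → ℤ) → ℂ := fun v => ∑ u ∈ p.support with π (ex u) = v,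
    coeff u p * chi (ex u - σ v) (expMap z₀)
  let J : Finset (Fin k → ℤ) := p.support.image fun u => π (ex u)
  -- collecting the monomials of `p` according to their restriction to the coset
  have hsum : ∀ t ∈ coset π (expMap z₀), eval t.incl p = ∑ v ∈ J, b v * chi (σ v) t := by
    intro t ht
    rw [MvPolynomial.eval_eq', ← Finset.sum_fiberwise_of_maps_to
      (fun u hu => Finset.mem_image_of_mem (fun u => π (ex u)) hu)]
    refine Finset.sum_congr rfl fun v _ => ?_
    rw [Finset.sum_mul]
    refine Finset.sum_congr rfl fun u hu => ?_
    obtain rfl := (Finset.mem_filter.1 hu).2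
    have h1 : chi (ex u) t = chi (ex u - σ (π (ex u))) (expMap z₀) * chi (σ (π (ex u))) t := by
      rw [← ht _ (by rw [map_sub, hπσ, sub_self]), ← chi_add, sub_add_cancel]
    have h2 : ∏ i, t.incl i ^ u i = (chi (ex u) t : ℂ) := by
      simp [chi, ex, Torus.incl]
    rw [h2, h1, Units.val_mul, mul_assoc]
  have hmem : ∀ z ∈ S, expMap z ∈ coset π (expMap z₀) := fun z hz m hm => by
    obtain ⟨c, hc⟩ := (hπ m).1 hm
    ext
    rw [chi_expMap, chi_expMap, hc z hz, hc z₀ hz₀]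
  have hprime := isPrime_vanishingIdeal hS
  have hzero : ∀ z : Fin n → ℂ, (∀ q ∈ vanishingIdeal ℂ S, eval z q = 0) → z ∈ S := by
    obtain ⟨P, rfl⟩ := (ZAffine.isClosed_iff S).1 hSc
    intro z hz q hq
    exact hz q fun w hw => hw q hq
  let g : (Fin k → ℤ) → MvPolynomial (Fin n) ℂ := fun v =>
    ∑ i, C (2 * Real.pi * Complex.I * σ v i) * X i
  have hg : ∀ v z, eval z (g v) = 2 * Real.pi * Complex.I * dot (σ v) z := by
    intro v z
    simp only [g, dot, map_sum, map_mul, eval_C, eval_X, Finset.mul_sum, mul_assoc]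
  have key := mem_of_sum_mul_exp_eq_zero (I := vanishingIdeal ℂ S)
    (fun q hq w hw => hq w fun r hr => hr w hw) (g := g) J (fun v _ v' _ hne c hc => by
      refine hne (sub_eq_zero.1 ?_)
      rw [← hπσ (v - v'), hπ]
      refine ⟨c / (2 * Real.pi * Complex.I), fun z hz => ?_⟩
      have h1 := hc z hz
      rw [aeval_eq_eval] at h1
      simp only [map_sub, eval_C] at h1
      have h1' : eval z (g v) - eval z (g v') - c = 0 := h1
      rw [hg, hg] at h1'
      rw [eq_div_iff Complex.two_pi_I_ne_zero, map_sub, dot_sub]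
      linear_combination h1') (fun v => C (b v)) (fun z hz => by
      have hzS := hzero z hz
      rw [← hp z hzS, hsum _ (hmem z hzS)]
      refine Finset.sum_congr rfl fun v _ => ?_
      rw [eval_C, hg, chi_expMap])
  rw [hsum t ht]
  refine Finset.sum_eq_zero fun v hv => ?_
  have := key v hv z₀ hz₀
  rw [aeval_C] at this
  rw [show b v = 0 from this, zero_mul]

end FunctionalLindemann

/-! ### Dimension of cosets -/

section Dimension

variable {k n : ℕ} {π : (Fin n → ℤ) →ₗ[ℤ] (Fin k → ℤ)} {σ : (Fin k → ℤ) →ₗ[ℤ] (Fin n → ℤ)}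

open TopologicalSpace in
/-- The dimension of a variety on which the linear forms in the kernel of `π` are constant is at
most `k`, since the variety is contained in an affine space of dimension `k`. -/
theorem length_le_of_forall_dot_eq (hπσ : ∀ v, π (σ v) = v)
    (l : LTSeries (IrreducibleCloseds (ZAffine n))) {z₀ : Fin n → ℂ}
    (h : ∀ z : Fin n → ℂ, z ∈ (l.last : Set (ZAffine n)) → ∀ m, π m = 0 → dot m z = dot m z₀) :
    l.length ≤ k := by
  let f : (Fin k → ℂ) → Fin n → ℂ := ZAffine.polyMap fun i =>
    MvPolynomial.C (z₀ i) + ∑ j, MvPolynomial.C (rowMatrix π i j : ℂ) * MvPolynomial.X j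
  let g : (Fin n → ℂ) → Fin k → ℂ := ZAffine.polyMap fun j =>
    ∑ i, MvPolynomial.C (σ (Pi.single j 1) i : ℂ) * (MvPolynomial.X i - MvPolynomial.C (z₀ i))
  have hf : ∀ w, f w = z₀ + fun i => dot (π (Pi.single i 1)) w := fun w => by
    funext i
    change MvPolynomial.eval (w : Fin k → ℂ) _ = _
    simp [dot, rowMatrix]
  have hg : ∀ z, g z = fun j => dot (σ (Pi.single j 1)) (z - z₀) := fun z => by
    funext j
    change MvPolynomial.eval (z : Fin n → ℂ) _ = _
    simp [dot]
  have hgf : Function.LeftInverse g f := fun w => by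
    funext j
    rw [hg, hf, add_sub_cancel_left]
    dsimp only
    rw [← dot_map π, hπσ, dot_single]
  have hemb := Function.LeftInverse.isEmbedding (X := ZAffine n) (Y := ZAffine k)
    (f := g) (g := f) hgf (ZAffine.continuous_polyMap _) (ZAffine.continuous_polyMap _)
  have hrange : (l.last : Set (ZAffine n)) ⊆ Set.range f := fun (z : Fin n → ℂ) hz => by
    refine ⟨g z, funext fun i => ?_⟩
    rw [hf, hg, Pi.add_apply, ← dot_map σ]
    have h1 := h z hz (Pi.single i 1 - σ (π (Pi.single i 1))) (by rw [map_sub, hπσ, sub_self])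
    rw [dot_sub, dot_sub, dot_single, dot_single] at h1
    rw [dot_sub_right]
    linear_combination -h1
  have := (hemb.isInducing.length_le_topologicalKrullDim l hrange).trans
    (ZAffine.topologicalKrullDim_le k)
  exact_mod_cast this

theorem isClosed_setOf_chi_eq (m : Fin n → ℤ) (c : ℂˣ) :
    IsClosed (X := ZTorus n) {t : Torus n | chi m t = c} := by
  -- the equation `χ t = c`, cleared of negative exponents
  let p : MvPolynomial (Fin n) ℂ := ∏ i, MvPolynomial.X i ^ (m i).toNat -
    MvPolynomial.C (c : ℂ) * ∏ i, MvPolynomial.X i ^ (-m i).toNat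
  convert ZTorus.isClosed_setOf_eval p using 1
  refine Set.ext fun (t : Torus n) => ?_
  change chi m t = c ↔ MvPolynomial.eval (Torus.incl t) p = 0
  have h1 : chi m t * ∏ i, t i ^ (-m i).toNat = ∏ i, t i ^ (m i).toNat := by
    rw [chi, ← Finset.prod_mul_distrib]
    refine Finset.prod_congr rfl fun i _ => ?_
    rw [← zpow_natCast, ← zpow_natCast, ← zpow_add]
    congr 1
    omega
  have h2 : MvPolynomial.eval (Torus.incl t) p =
      ((∏ i, t i ^ (m i).toNat : ℂˣ) : ℂ) - c * (∏ i, t i ^ (-m i).toNat : ℂˣ) := by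
    simp [p, Torus.incl]
  rw [h2, ← h1, sub_eq_zero, ← Units.val_mul, Units.val_inj, mul_left_inj]

/-- The part of a coset of a `k`-dimensional subtorus where the last `k - r` parameters
are `1`. For `r = 0, …, k` these sets form a chain of irreducible closed sets. -/
def partialCoset (π : (Fin n → ℤ) →ₗ[ℤ] (Fin k → ℤ)) (τ : Torus n) (r : ℕ) : Set (Torus n) :=
  (fun s => τ * monomialHom (rowMatrix π) s) '' {s | ∀ j : Fin k, r ≤ j → s j = 1}

theorem isIrreducible_partialCoset (τ : Torus n) (r : ℕ) :
    IsIrreducible (X := ZTorus n) (partialCoset π τ r) := by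
  let e : (Fin k → ℂ) → ZTorus n := fun w =>
    τ * monomialHom (rowMatrix π) (expMap fun j => if r ≤ (j : ℕ) then 0 else w j)
  have hrange : partialCoset π τ r = Set.range e := by
    ext t
    constructor
    · rintro ⟨s, hs, rfl⟩
      refine ⟨fun j => Complex.log (s j) / (2 * Real.pi * Complex.I), ?_⟩
      simp only [e]
      congr 2
      funext j
      ext
      simp only [expMap, Units.val_mk0]
      split_ifs with h
      · simp [hs j h]
      · rw [mul_div_cancel₀ _ Complex.two_pi_I_ne_zero, Complex.exp_log (Units.ne_zero _)]
    · rintro ⟨w, rfl⟩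
      refine ⟨_, fun j hj => ?_, rfl⟩
      ext
      simp [expMap, hj]
  rw [hrange]
  refine ZTorus.isIrreducible_range e fun u v i => ?_
  have : ∀ c : ℂ, Torus.incl (e (u + c • v)) i = τ i * Complex.exp (2 * Real.pi * Complex.I *
      ∑ j, π (Pi.single i 1) j * (if r ≤ (j : ℕ) then 0 else u j + c * v j)) := by
    intro c
    change ((τ i * chi (π (Pi.single i 1)) (expMap _) : ℂˣ) : ℂ) = _
    rw [Units.val_mul, chi_expMap]
    rfl
  simp only [this]
  refine Differentiable.const_mul (Differentiable.cexp (Differentiable.const_mul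
    (Differentiable.fun_sum fun j _ => Differentiable.const_mul ?_ _) _)) _
  split_ifs <;> fun_prop

theorem isClosed_partialCoset (hπσ : ∀ v, π (σ v) = v) (τ : Torus n) (r : ℕ) :
    IsClosed (X := ZTorus n) (partialCoset π τ r) := by
  have heq : partialCoset π τ r = (⋂ (m : Fin n → ℤ) (_ : π m = 0),
      {t : Torus n | chi m t = chi m τ}) ∩ ⋂ (j : Fin k) (_ : r ≤ j),
      {t : Torus n | chi (σ (Pi.single j 1)) t = chi (σ (Pi.single j 1)) τ} := by
    ext t
    simp only [Set.mem_inter_iff, Set.mem_iInter]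
    constructor
    · rintro ⟨s, hs, rfl⟩
      refine ⟨fun m hm => ?_, fun j hj => ?_⟩
      · change chi m (τ * monomialHom (rowMatrix π) s) = _
        rw [chi_mul, chi_monomialHom, hm]
        simp [chi]
      · change chi _ (τ * monomialHom (rowMatrix π) s) = _
        rw [chi_mul, chi_monomialHom, hπσ, chi_single, hs j hj, mul_one]
    · rintro ⟨h1, h2⟩
      refine ⟨fun j => chi (σ (Pi.single j 1)) (τ⁻¹ * t), fun j hj => ?_, ?_⟩
      · have : chi _ t = _ := h2 j hj
        dsimp only
        rw [chi_mul, chi_inv, this, inv_mul_cancel]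
      · dsimp only
        rw [monomialHom_chi hπσ fun m hm => ?_, mul_inv_cancel_left]
        have : chi m t = _ := h1 m hm
        rw [chi_mul, chi_inv, this, inv_mul_cancel]
  rw [heq]
  exact IsClosed.inter (X := ZTorus n) (isClosed_biInter fun m _ => isClosed_setOf_chi_eq _ _)
    (isClosed_biInter fun j _ => isClosed_setOf_chi_eq _ _)

theorem partialCoset_ssubset (hπσ : ∀ v, π (σ v) = v) (τ : Torus n) {r : ℕ} (hr : r < k) :
    partialCoset π τ r ⊂ partialCoset π τ (r + 1) := by
  refine ⟨Set.image_mono fun s hs j hj => hs j (by omega), fun hsub => ?_⟩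
  let s : Torus k := Pi.mulSingle ⟨r, hr⟩ (Units.mk0 2 two_ne_zero)
  obtain ⟨s', hs', heq⟩ := hsub ⟨s, fun j hj => Pi.mulSingle_eq_of_ne (by
    rintro rfl
    simp at hj) _, rfl⟩
  have := monomialHom_rowMatrix_injective hπσ (mul_left_cancel heq)
  have h1 := hs' ⟨r, hr⟩ le_rfl
  rw [this] at h1
  simp [s, Units.ext_iff] at h1

theorem partialCoset_self (hπσ : ∀ v, π (σ v) = v) (τ : Torus n) :
    partialCoset π τ k = coset π τ := by
  rw [coset_eq hπσ, partialCoset]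
  ext t
  constructor
  · rintro ⟨s, -, rfl⟩
    exact ⟨_, ⟨s, rfl⟩, rfl⟩
  · rintro ⟨_, ⟨s, rfl⟩, rfl⟩
    exact ⟨s, fun j hj => absurd j.2 (by omega), rfl⟩

open TopologicalSpace in
/-- An irreducible closed set strictly containing a coset of a `k`-dimensional subtorus has
dimension greater than `k`. -/
theorem succ_le_topologicalKrullDim_of_coset_ssubset (hπσ : ∀ v, π (σ v) = v) {τ : Torus n}
    {T : Set (ZTorus n)} (hT : IsIrreducible T) (hTc : IsClosed T) (hτT : coset π τ ⊂ T) :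
    ((k + 1 : ℕ) : WithBot ℕ∞) ≤ topologicalKrullDim T := by
  let l : LTSeries (IrreducibleCloseds (ZTorus n)) :=
    { length := k
      toFun := fun i => ⟨partialCoset π τ i, isIrreducible_partialCoset τ i,
        isClosed_partialCoset hπσ τ i⟩
      step := fun i => partialCoset_ssubset hπσ τ i.2 }
  have hlast : l.last < ⟨T, hT, hTc⟩ := by
    change partialCoset π τ k ⊂ T
    rwa [partialCoset_self hπσ]
  have := IsInducing.length_le_topologicalKrullDim (IsInducing.subtypeVal (t := T))
    (l.snoc ⟨T, hT, hTc⟩ hlast) (by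
      rw [RelSeries.last_snoc, Subtype.range_coe]
      rfl)
  exact this

end Dimension

/-! ### Algebraic points and torsion cosets -/

/-- A system of polynomial equations with algebraic coefficients that has a complex solution has an
algebraic solution. -/
theorem exists_algebraic_zero {σ : Type*} [Finite σ] (P : Set (MvPolynomial σ Qbar))
    (hP : ∃ z : σ → ℂ, ∀ p ∈ P, MvPolynomial.aeval z p = 0) :
    ∃ w : σ → Qbar, ∀ p ∈ P, MvPolynomial.aeval (fun i => (w i : ℂ)) p = 0 := by
  obtain ⟨z, hz⟩ := hP
  have : IsAlgClosed Qbar := (algebraicClosure.isAlgClosure ℚ ℂ).isAlgClosed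
  have hne : (MvPolynomial.zeroLocus Qbar (Ideal.span P)).Nonempty := by
    by_contra hempty
    rw [Set.not_nonempty_iff_eq_empty] at hempty
    have h1 := MvPolynomial.vanishingIdeal_zeroLocus_eq_radical (K := Qbar) (Ideal.span P)
    rw [hempty, MvPolynomial.vanishingIdeal_empty] at h1
    have h2 : (1 : MvPolynomial σ Qbar) ∈ Ideal.span P :=
      (Ideal.eq_top_iff_one _).1 (Ideal.radical_eq_top.1 h1.symm)
    have h3 : Ideal.span P ≤ RingHom.ker (MvPolynomial.aeval (R := Qbar) z) :=
      Ideal.span_le.2 hz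
    have h4 := h3 h2
    rw [RingHom.mem_ker, map_one] at h4
    exact one_ne_zero h4
  obtain ⟨w, hw⟩ := hne
  refine ⟨w, fun p hp => ?_⟩
  have h1 : MvPolynomial.aeval w p = 0 := hw p (Ideal.subset_span hp)
  have h2 := MvPolynomial.aeval_algebraMap_apply ℂ w p
  rw [h1, map_zero] at h2
  exact h2

theorem isAlgebraic_coe (w : Qbar) : IsAlgebraic ℚ (w : ℂ) :=
  mem_algebraicClosure_iff.1 w.2

theorem exists_isAlgebraic_mem {n : ℕ} {S : Set (Fin n → ℂ)} (hS : IsClosedOverQbar S)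
    (hne : S.Nonempty) : ∃ z ∈ S, ∀ i, IsAlgebraic ℚ (z i) := by
  obtain ⟨P, rfl⟩ := hS
  obtain ⟨w, hw⟩ := exists_algebraic_zero P hne
  exact ⟨_, hw, fun i => isAlgebraic_coe (w i)⟩

theorem exists_isAlgebraic_mem_torus {n : ℕ} {T : Set (Torus n)} (hT : IsTorusClosedOverQbar T)
    (hne : T.Nonempty) : ∃ t ∈ T, ∀ i, IsAlgebraic ℚ (t i : ℂ) := by
  obtain ⟨P, rfl⟩ := hT
  obtain ⟨t, ht⟩ := hne
  -- the variables indexed by the second summand are the inverses of the first ones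
  let P' : Set (MvPolynomial (Fin n ⊕ Fin n) Qbar) := (MvPolynomial.rename Sum.inl) '' P ∪
    Set.range fun i => MvPolynomial.X (Sum.inl i) * MvPolynomial.X (Sum.inr i) - 1
  obtain ⟨w, hw⟩ := exists_algebraic_zero P' ⟨Sum.elim t.incl t⁻¹.incl, by
    rintro p (⟨p, hp, rfl⟩ | ⟨i, rfl⟩)
    · rw [MvPolynomial.aeval_rename, Sum.elim_comp_inl]
      exact ht p hp
    · simp [Torus.incl]⟩
  have hinv : ∀ i, (w (Sum.inl i) : ℂ) * w (Sum.inr i) = 1 := fun i => by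
    have := hw _ (Or.inr ⟨i, rfl⟩)
    simpa [sub_eq_zero] using this
  refine ⟨fun i => Units.mk0 (w (Sum.inl i) : ℂ) (left_ne_zero_of_mul_eq_one (hinv i)),
    fun p hp => ?_, fun i => isAlgebraic_coe _⟩
  have := hw _ (Or.inl ⟨p, hp, rfl⟩)
  rwa [MvPolynomial.aeval_rename] at this

theorem isAlgebraic_dot {n : ℕ} (m : Fin n → ℤ) {z : Fin n → ℂ} (hz : ∀ i, IsAlgebraic ℚ (z i)) :
    IsAlgebraic ℚ (dot m z) := by
  have h : ∀ i, z i ∈ integralClosure ℚ ℂ := fun i => (hz i).isIntegral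
  have : dot m z ∈ integralClosure ℚ ℂ :=
    Subalgebra.sum_mem _ fun i _ => Subalgebra.mul_mem _ (Subalgebra.intCast_mem _ _) (h i)
  exact IsIntegral.isAlgebraic this

theorem isAlgebraic_chi {n : ℕ} (m : Fin n → ℤ) {t : Torus n} (ht : ∀ i, IsAlgebraic ℚ (t i : ℂ)) :
    IsAlgebraic ℚ (chi m t : ℂ) := by
  have h : ∀ i, (t i : ℂ) ∈ Qbar := fun i => mem_algebraicClosure_iff.2 (ht i)
  have : (chi m t : ℂ) ∈ Qbar := by
    simp only [chi, Units.coe_prod, Units.val_zpow_eq_zpow_val]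
    exact prod_mem fun i _ => zpow_mem (h i) _
  exact mem_algebraicClosure_iff.1 this

theorem isOfFinOrder_expMap_ratCast {n : ℕ} (q : Fin n → ℚ) :
    IsOfFinOrder (expMap fun i => (q i : ℂ)) := by
  refine isOfFinOrder_iff_pow_eq_one.2 ⟨∏ i, (q i).den, Finset.prod_pos fun i _ => (q i).pos, ?_⟩
  funext i
  ext
  obtain ⟨c, hc⟩ := Finset.dvd_prod_of_mem (fun i => (q i).den) (Finset.mem_univ i)
  simp only [Pi.pow_apply, expMap, Units.val_pow_eq_pow_val, Units.val_mk0, Pi.one_apply,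
    Units.val_one, ← Complex.exp_nat_mul, Complex.exp_eq_one_iff]
  refine ⟨c * (q i).num, ?_⟩
  have h1 : ((q i).den : ℂ) * (q i : ℂ) = (q i).num := by
    exact_mod_cast (q i).den_mul_eq_num
  rw [hc]
  push_cast
  linear_combination (c * (2 * Real.pi * Complex.I)) * h1

theorem isClosed_of_isClosedOverQbar {n : ℕ} {S : Set (Fin n → ℂ)} (hS : IsClosedOverQbar S) :
    IsClosed (X := ZAffine n) S := by
  obtain ⟨P, rfl⟩ := hS
  refine (ZAffine.isClosed_iff _).2 ⟨MvPolynomial.map (algebraMap Qbar ℂ) '' P, ?_⟩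
  refine Set.ext fun (z : Fin n → ℂ) => ?_
  change (∀ p ∈ P, _) ↔ ∀ q ∈ MvPolynomial.map (algebraMap Qbar ℂ) '' P, MvPolynomial.eval z q = 0
  rw [Set.forall_mem_image]
  exact forall₂_congr fun p _ => by rw [MvPolynomial.eval_map, MvPolynomial.aeval_def]

theorem isClosed_of_isTorusClosedOverQbar {n : ℕ} {T : Set (Torus n)}
    (hT : IsTorusClosedOverQbar T) : IsClosed (X := ZTorus n) T := by
  obtain ⟨P, rfl⟩ := hT
  exact (isClosed_of_isClosedOverQbar ⟨P, rfl⟩).preimage ZTorus.isInducing_toAffine.continuous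

/-- A coset of a subtorus that contains a point with algebraic coordinates, and the exponential of
a point with algebraic coordinates, is a torsion coset. -/
theorem isTorsionTranslate_coset {k n : ℕ} {π : (Fin n → ℤ) →ₗ[ℤ] (Fin k → ℤ)}
    {σ : (Fin k → ℤ) →ₗ[ℤ] (Fin n → ℤ)} (hπσ : ∀ v, π (σ v) = v) {z : Fin n → ℂ}
    (hz : ∀ i, IsAlgebraic ℚ (z i)) {t : Torus n} (ht : ∀ i, IsAlgebraic ℚ (t i : ℂ))
    (htz : t ∈ coset π (expMap z)) : IsTorsionTranslate (coset π (expMap z)) := by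
  have hrat : ∀ m, π m = 0 → ∃ q : ℚ, dot m z = q := fun m hm =>
    exists_rat_of_isAlgebraic_of_isAlgebraic_exp (isAlgebraic_dot m hz) (by
      rw [← chi_expMap, ← htz m hm]
      exact isAlgebraic_chi m ht)
  choose q hq using fun i => hrat (Pi.single i 1 - σ (π (Pi.single i 1)))
    (by rw [map_sub, hπσ, sub_self])
  -- the forms in the kernel of `π` vanish on the difference of `z` and the rational point `q`
  have hqz : (fun i => (q i : ℂ)) = z - fun i => dot (σ (π (Pi.single i 1))) z := by
    funext i
    rw [← hq, dot_sub, dot_single]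
    rfl
  have hcoset : coset π (expMap z) = coset π (expMap fun i => (q i : ℂ)) := by
    have : ∀ m, π m = 0 → chi m (expMap z) = chi m (expMap fun i => (q i : ℂ)) := fun m hm => by
      ext
      rw [chi_expMap, chi_expMap, hqz, dot_sub_right]
      have := dot_map (σ ∘ₗ π) m z
      simp only [LinearMap.comp_apply] at this
      rw [← this, hm, map_zero]
      simp [dot]
    ext t
    exact forall₂_congr fun m hm => by rw [this m hm]
  rw [hcoset, coset_eq hπσ]
  exact ⟨_, _, isOfFinOrder_expMap_ratCast q,
    ⟨k, rowMatrix π, monomialHom_rowMatrix_injective hπσ, rfl⟩, rfl⟩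

/-- The integral linear forms that are constant on a set. -/
def constantForms {n : ℕ} (S : Set (Fin n → ℂ)) : Submodule ℤ (Fin n → ℤ) where
  carrier := {m | ∃ c, ∀ z ∈ S, dot m z = c}
  zero_mem' := ⟨0, fun z _ => by simp [dot]⟩
  add_mem' := by
    rintro m m' ⟨c, hc⟩ ⟨c', hc'⟩
    exact ⟨c + c', fun z hz => by rw [dot_add, hc z hz, hc' z hz]⟩
  smul_mem' := by
    rintro a m ⟨c, hc⟩
    exact ⟨a * c, fun z hz => by rw [dot_zsmul, hc z hz]⟩

/-- The lattice of constant forms is saturated. -/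
theorem mem_constantForms_of_smul_mem {n : ℕ} {S : Set (Fin n → ℂ)} (a : ℤ) (m : Fin n → ℤ)
    (ha : a ≠ 0) (h : a • m ∈ constantForms S) : m ∈ constantForms S := by
  obtain ⟨c, hc⟩ := h
  refine ⟨c / a, fun z hz => ?_⟩
  rw [← hc z hz, dot_zsmul, mul_div_cancel_left₀]
  exact_mod_cast ha

theorem exists_dimIn_torus_eq {n : ℕ} {T : Set (ZTorus n)} (hT : IsIrreducible T)
    (hTc : IsClosed T) : ∃ D : ℕ, topologicalKrullDim T = D := by
  have h1 : topologicalKrullDim T ≤ n :=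
    (topologicalKrullDim_subspace_le (ZTorus n) T).trans (ZTorus.topologicalKrullDim_le n)
  have h0 : (0 : ℕ) ≤ topologicalKrullDim T :=
    IsInducing.length_le_topologicalKrullDim (IsInducing.subtypeVal (t := T))
      (RelSeries.singleton _ (⟨T, hT, hTc⟩ : TopologicalSpace.IrreducibleCloseds (ZTorus n)))
      (by rw [Subtype.range_coe]; exact subset_rfl)
  generalize topologicalKrullDim T = x at h0 h1
  rcases x with _ | _ | D
  · exact absurd h0 (WithBot.not_coe_le_bot _)
  · exact absurd (top_le_iff.1 (WithBot.coe_le_coe.1 h1)) (ENat.natCast_ne_top n)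
  · exact ⟨D, rfl⟩

end ExpTorus

/-! ### Exponentials landing in a variety of the same dimension -/

open ExpTorus

theorem mainTheorem5 (n : ℕ) (S : Set (Fin n → ℂ)) (T : Set (ExpTorus.Torus n))
    (hS : ExpTorus.IsClosedOverQbar S)
    (hT : ExpTorus.IsTorusClosedOverQbar T)
    (hirr : @IsIrreducible (ExpTorus.Torus n) (ExpTorus.torusZariski n) T)
    (hdim : ExpTorus.dimIn (ExpTorus.zariski n) S = ExpTorus.dimIn (ExpTorus.torusZariski n) T)
    (hexp : ExpTorus.expMap '' S ⊆ T) :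
    ExpTorus.IsTorsionTranslate T := by
  have hSc := isClosed_of_isClosedOverQbar hS
  have hTc := isClosed_of_isTorusClosedOverQbar hT
  obtain ⟨D, hD⟩ := exists_dimIn_torus_eq (T := T) hirr hTc
  have hDS : (D : WithBot ℕ∞) ≤ dimIn (zariski n) S :=
    (hdim.trans hD).ge
  -- an irreducible closed subset of `S` of the same dimension
  obtain ⟨l, rfl, hlS⟩ := hSc.exists_ltSeries_of_le_topologicalKrullDim hDS
  let S' : Set (Fin n → ℂ) := (l.last : Set (ZAffine n))
  have hS' : IsIrreducible (X := ZAffine n) S' := l.last.isIrreducible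
  have hS'c : IsClosed (X := ZAffine n) S' := l.last.isClosed
  obtain ⟨z₀, hz₀⟩ : S'.Nonempty := hS'.nonempty
  obtain ⟨k, π, σ, hπσ, hπ⟩ := exists_projection_section (constantForms S')
    mem_constantForms_of_smul_mem
  have hcoset : coset π (expMap z₀) ⊆ T := by
    obtain ⟨P, rfl⟩ := (ZTorus.isClosed_iff T).1 hTc
    exact fun t ht p hp => eval_eq_zero_of_mem_coset hS' hS'c hπσ hπ
      (fun z hz => hexp ⟨z, hlS hz, rfl⟩ p hp) hz₀ ht
  have hk : l.length ≤ k := length_le_of_forall_dot_eq hπσ l (z₀ := z₀) fun z hz m hm => by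
    obtain ⟨c, hc⟩ := (hπ m).1 hm
    rw [hc z hz, hc z₀ hz₀]
  have hTeq : T = coset π (expMap z₀) := by
    by_contra hne
    have := succ_le_topologicalKrullDim_of_coset_ssubset hπσ (T := T) hirr hTc
      (hcoset.ssubset_of_ne (Ne.symm hne))
    rw [hD] at this
    have : k + 1 ≤ l.length := by exact_mod_cast this
    omega
  obtain ⟨z, hzS, hz⟩ := exists_isAlgebraic_mem hS ⟨z₀, hlS hz₀⟩
  obtain ⟨t, htT, ht⟩ := exists_isAlgebraic_mem_torus hT
    (IsIrreducible.nonempty (X := ZTorus n) hirr)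
  have hzT : expMap z ∈ coset π (expMap z₀) := hTeq ▸ hexp ⟨z, hzS, rfl⟩
  have hTz : T = coset π (expMap z) := by
    rw [hTeq]
    ext t
    exact forall₂_congr fun m hm => by rw [hzT m hm]
  rw [hTz]
  exact isTorsionTranslate_coset hπσ hz ht (hTz ▸ htT)
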